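/- Setting. Let $\mathcal W$ be the symmetric $N\times N$ matrix of nonnegative edge weights of a graph on $N$ nodes, $\mathcal L=\mathcal D-\mathcal W$ its Laplacian (where $\mathcal D$ is diagonal with $d_{ii}=\sum_j w_{ij}$), and $\mathcal L=\mathbf Q\boldsymbol\Lambda_{\mathcal L}\mathbf Q^{\mathsf T}$ an eigendecomposition with $\mathbf Q$ orthogonal and the eigenvalues in increasing order. Let $\mathbf b_1,\dots,\mathbf b_N$ be the rows of $\mathbf Q$ (the features of the $N$ arms), let $\lambda>0$ and $\boldsymbol\Lambda=\boldsymbol\Lambda_{\mathcal L}+\lambda\mathbf I_N$, with eigenvalues $\lambda=\lambda_1\le\dots\le\lambda_N$, and write $\|\mathbf x\|_{\boldsymbol\Lambda}=\sqrt{\mathbf x^{\mathsf T}\boldsymbol\Lambda\mathbf x}$. Let $T\ge 1$, $0<\delta<1$, $R\ge 0$, and let the effective dimension $d$ be the largest $d\in\{1,\dots,N\}$ such that $$(d-1)\lambda_d\le\frac{T}{\ln(1+T/\lambda)}.$$ Let $\boldsymbol\mu\in\mathbb R^N$ be a fixed (unknown) vector. Spectral Thompson Sampling runs as follows, with $$v=R\sqrt{6d\ln\frac{\lambda+T}{\delta\lambda}}+C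 .$$ In round $t=1,\dots,T$, given the history $\mathcal H_{t-1}=\{a(\tau),r(\tau):\tau<t\}$, it draws a sample $\tilde{\boldsymbol\mu}(t)$ from $\mathcal N(\hat{\boldsymbol\mu}(t),v^2\mathbf B_t^{-1})$, where $$\mathbf B_t=\boldsymbol\Lambda+\sum_{\tau<t}\mathbf b_{a(\tau)}\mathbf b_{a(\tau)}^{\mathsf T},\qquad \hat{\boldsymbol\mu}(t)=\mathbf B_t^{-1}\sum_{\tau<t}\mathbf b_{a(\tau)}r(\tau);$$ it plays an arm $a(t)$ that maximizes $\mathbf b_i^{\mathsf T}\tilde{\boldsymbol\mu}(t)$ over $i$, and it receives $r(t)=\mathbf b_{a(t)}^{\mathsf T}\boldsymbol\mu+\varepsilon_t$. The noise $\varepsilon_t$ is $R$-sub-Gaussian given the past and the arm played: for all $\xi\in\mathbb R$, $\mathbb E[e^{\xi\varepsilon_t}\mid\mathcal H_{t-1},a(t)]\le\exp(\xi^2R^2/2)$ almost surely. Let $a^*$ be an arm maximizing $\mathbf b_i^{\mathsf T}\boldsymbol\mu$, and let $\mathcal R(T)=\sum_{t=1}^T\big(\mathbf b_{a^*}^{\mathsf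 T}\boldsymbol\mu-\mathbf b_{a(t)}^{\mathsf T}\boldsymbol\mu\big)$ be the cumulative regret. Theorem. If $\|\boldsymbol\mu\|_{\boldsymbol\Lambda}\le C$ and $|\mathbf b_i^{\mathsf T}\boldsymbol\mu|\le 1$ for all $i$, then with probability at least $1-\delta$, $$\mathcal R(T)\le\frac{11g}{p}\sqrt{\frac{4+4\lambda}{\lambda}\,dT\ln\frac{\lambda+T}{\lambda}}+\frac1T+\frac gp\left(\frac{11}{\sqrt\lambda}+2\right)\sqrt{2T\ln\frac2\delta},$$ where $p=1/(4e\sqrt\pi)$ and $$g=\sqrt{4\ln(TN)}\left(R\sqrt{6d\ln\frac{\lambda+T}{\delta\lambda}}+C\right)+R\sqrt{2d\ln\frac{(\lambda+T)T^2}{\delta\lambda}}+C .$$ -/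

import Mathlib

open MeasureTheory ProbabilityTheory Matrix Finset

namespace SpectralTS

noncomputable section

/-- The graph Laplacian `𝓛 = 𝓓 - 𝓦` of a weighted graph on `N` nodes with weight matrix `W`. -/
def laplacian {N : ℕ} (W : Matrix (Fin N) (Fin N) ℝ) : Matrix (Fin N) (Fin N) ℝ :=
  diagonal (fun i => ∑ j, W i j) - W

/-- `W` is the weight matrix of an undirected graph with nonnegative weights, and
`𝓛 = Q Λ_𝓛 Qᵀ` is an eigendecomposition of its Laplacian: `Q` is orthogonal, with eigenvectors
in its columns, and `Λ_𝓛` is the diagonal matrix of the eigenvalues `ev`, in increasing order.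
The feature vector `b_i` of arm `i` is the row `Q i`. -/
structure IsSpectralBasis {N : ℕ} (W Q : Matrix (Fin N) (Fin N) ℝ) (ev : Fin N → ℝ) : Prop where
  symm : W.IsSymm
  nonneg : ∀ i j, 0 ≤ W i j
  orthogonal : Q ∈ Matrix.orthogonalGroup (Fin N) ℝ
  decomposition : laplacian W = Q * diagonal ev * Qᵀ
  monotone : Monotone ev

/-- The regularized spectrum `Λ = Λ_𝓛 + lam • I`. -/
def regSpectrum {N : ℕ} (ev : Fin N → ℝ) (lam : ℝ) : Matrix (Fin N) (Fin N) ℝ :=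
  diagonal ev + lam • (1 : Matrix (Fin N) (Fin N) ℝ)

/-- The norm `‖x‖_M = √(xᵀ M x)`. -/
def matNorm {N : ℕ} (M : Matrix (Fin N) (Fin N) ℝ) (x : Fin N → ℝ) : ℝ :=
  √(x ⬝ᵥ (M *ᵥ x))

open Classical in
/-- The effective dimension: the largest `d ∈ {1, …, N}` such that
`(d - 1) λ_d ≤ T / ln (1 + T / lam)`, where `λ_1 ≤ … ≤ λ_N` are the eigenvalues of
`Λ = Λ_𝓛 + lam • I`. The value `i : Fin N` stands for `d = i + 1`. -/
def effDim {N : ℕ} (ev : Fin N → ℝ) (lam : ℝ) (T : ℕ) : ℕ :=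
  (univ.filter (fun i : Fin N =>
    (i : ℝ) * (ev i + lam) ≤ (T : ℝ) / Real.log (1 + (T : ℝ) / lam))).sup (fun i => (i : ℕ) + 1)

/-- Rounds are numbered `0, 1, 2, …`. The matrix `Λ + ∑_{τ < t} b_{a(τ)} b_{a(τ)}ᵀ` available
before round `t`, for the sequence `a` of arms. -/
def designMatrix {N : ℕ} (Q : Matrix (Fin N) (Fin N) ℝ) (ev : Fin N → ℝ) (lam : ℝ)
    (a : ℕ → Fin N) (t : ℕ) : Matrix (Fin N) (Fin N) ℝ :=
  regSpectrum ev lam + ∑ τ ∈ range t, vecMulVec (Q (a τ)) (Q (a τ))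

/-- The estimate `B⁻¹ (∑_{τ < t} b_{a(τ)} r(τ))` of the unknown vector before round `t`,
where `B` is the matrix `designMatrix` before round `t`; it is `0` before the first round. -/
def estimate {N : ℕ} (Q : Matrix (Fin N) (Fin N) ℝ) (ev : Fin N → ℝ) (lam : ℝ)
    (a : ℕ → Fin N) (r : ℕ → ℝ) (t : ℕ) : Fin N → ℝ :=
  (designMatrix Q ev lam a t)⁻¹ *ᵥ (∑ τ ∈ range t, r τ • Q (a τ))

/-- The payoff `r(t) = b_{a(t)}ᵀ μ + ε_t`. -/
def reward {Ω : Type*} {N : ℕ} (Q : Matrix (Fin N) (Fin N) ℝ) (mu : Fin N → ℝ)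
    (a : ℕ → Ω → Fin N) (ε : ℕ → Ω → ℝ) (t : ℕ) (ω : Ω) : ℝ :=
  Q (a t ω) ⬝ᵥ mu + ε t ω

/-- The history before round `t`: the σ-algebra generated by `a(τ)` and `r(τ)` for `τ < t`. -/
abbrev history {Ω : Type*} {N : ℕ} (a : ℕ → Ω → Fin N) (r : ℕ → Ω → ℝ) (t : ℕ) :
    MeasurableSpace Ω :=
  ⨆ τ : ℕ, ⨆ _ : τ < t,
    (MeasurableSpace.comap (a τ) inferInstance ⊔ MeasurableSpace.comap (r τ) inferInstance)

/-- `X` is `R`-sub-Gaussian conditionally on `m`: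
`E[exp (ξ X) | m] ≤ exp (ξ² R² / 2)` almost surely, for every real `ξ`. -/
def CondSubGaussian {Ω : Type*} {mΩ : MeasurableSpace Ω} (P : Measure Ω)
    (m : MeasurableSpace Ω) (X : Ω → ℝ) (R : ℝ) : Prop :=
  ∀ ξ : ℝ, Integrable (fun ω => Real.exp (ξ * X ω)) P ∧
    ∀ᵐ ω ∂P, (P[fun ω => Real.exp (ξ * X ω) | m]) ω ≤ Real.exp (ξ ^ 2 * R ^ 2 / 2)

/-- The scale `v = R √(6 d ln ((lam + T) / (δ lam))) + C` of the sampling distribution. -/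
def sampleScale (R C lam δ : ℝ) (d T : ℕ) : ℝ :=
  R * √(6 * d * Real.log ((lam + T) / (δ * lam))) + C

/-- `T` rounds of Thompson Sampling with scale `v` in the linear bandit whose features are the
rows of `Q` and whose unknown vector is `mu`. Here `a t` is the arm played, `muTilde t` the
sample and `ε t` the noise of round `t`. -/
structure IsThompsonRun {Ω : Type*} {mΩ : MeasurableSpace Ω} (P : Measure Ω) {N : ℕ}
    (Q : Matrix (Fin N) (Fin N) ℝ) (ev : Fin N → ℝ) (lam v R : ℝ) (mu : Fin N → ℝ) (T : ℕ)
    (a : ℕ → Ω → Fin N) (muTilde : ℕ → Ω → EuclideanSpace ℝ (Fin N)) (ε : ℕ → Ω → ℝ) :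
    Prop where
  measurable_arm : ∀ t < T, Measurable (a t)
  measurable_sample : ∀ t < T, Measurable (muTilde t)
  measurable_noise : ∀ t < T, Measurable (ε t)
  /-- Given the history, the sample of round `t` has law `𝒩(μ̂(t), v² B_t⁻¹)`. -/
  sample_law : ∀ t < T, ∀ S : Set (EuclideanSpace ℝ (Fin N)), MeasurableSet S →
    P⟦muTilde t ⁻¹' S | history a (reward Q mu a ε) t⟧ =ᵐ[P] fun ω =>
      (multivariateGaussian
        (WithLp.toLp 2
          (estimate Q ev lam (fun τ => a τ ω) (fun τ => reward Q mu a ε τ ω) t))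
        (v ^ 2 • (designMatrix Q ev lam (fun τ => a τ ω) t)⁻¹)).real S
  /-- The arm played maximizes `b_iᵀ μ̃(t)`. -/
  arm_maximizes : ∀ t < T, ∀ ω, ∀ i,
    Q i ⬝ᵥ (muTilde t ω).ofLp ≤ Q (a t ω) ⬝ᵥ (muTilde t ω).ofLp
  /-- The noise is `R`-sub-Gaussian given the history and the arm played. -/
  noise_subGaussian : ∀ t < T,
    CondSubGaussian P
      (history a (reward Q mu a ε) t ⊔ MeasurableSpace.comap (a t) inferInstance) (ε t) R

/-- The cumulative regret over `T` rounds of the sequence `a` of arms, with respect to the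
optimal arm `aStar`. -/
def regret {N : ℕ} (Q : Matrix (Fin N) (Fin N) ℝ) (mu : Fin N → ℝ) (aStar : Fin N)
    (a : ℕ → Fin N) (T : ℕ) : ℝ :=
  ∑ t ∈ range T, (Q aStar ⬝ᵥ mu - Q (a t) ⬝ᵥ mu)

end

end SpectralTS

/-!
# The regret of spectral Thompson Sampling

Let `s_i(t) = ‖b_i‖_{B_t⁻¹}` be the width of arm `i`, `Δ_i` its gap, and `p = 1 / (4 e √π)`. The
regret is controlled by the widths of the arms played, and those widths have a small sum.

*Widths.* The squared widths of the arms played sum to at most a multiple of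
`log (det B_T / det Λ)` (`sum_sq_width_le`). By Hadamard's inequality this logarithm is at most
`∑ i, log (1 + c_i / λ_i)` with `∑ c_i ≤ T`; the first `d` terms are at most `log (1 + T / lam)`
each, and the definition of the effective dimension `d` bounds the sum of the others by the same
total (`log_det_designMatrix_le`).

*Estimation.* For noise of variance proxy `1`, the process
`√(det Λ / det B_t) exp (‖∑ ε_τ b_{a(τ)}‖²_{B_t⁻¹} / 2)` is a nonnegative supermartingale: by the
Sherman-Morrison formula one step involves only a quadratic exponential in the new noise, which is
a Gaussian mixture of the exponentials that the sub-Gaussian hypothesis controls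
(`lintegral_exp_quadratic_le`). Ville's inequality bounds all the estimation errors in the
directions `b_i` at once, by `ℓ s_i(t)` with `ℓ` at most the sampling scale `v`
(`IsThompsonRun.measure_estimate_error_gt_le`).

*Sampling.* Given the history, and where the estimates are accurate, the sample makes the optimal
arm look at least as good as it is with probability at least `p`, because `ℓ ≤ v` and a standard
Gaussian exceeds `1` with probability at least `p`. It is also within `√(4 log (T N)) v s_i(t)` of
the estimate for all arms, except with probability at most `2 / T²`. Call an arm unsaturated if
`Δ_i ≤ g s_i(t)`, and let `s̄` be the least width of an unsaturated arm. If both events occur, the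
arm played is unsaturated, so its expected width is at least a multiple of `p s̄`; and the second
event alone bounds its gap by `2 g s̄ + g s_{a(t)}(t)`. Hence the regret of a round minus
`(5 g / p) s_{a(t)}(t)` and a negligible constant has nonpositive conditional expectation
(`IsThompsonRun.integral_mul_compensatedRegret_nonpos`), and the Azuma-Hoeffding inequality
(`measure_sum_gt_le`) concludes.

The inequality `ℓ ≤ v` needs `lam ≤ T`, and `2 / T²` has to be small compared with `p`. If
`T < lam` or `T < 100`, the right-hand side already exceeds the bound `2 T C / √lam`, which always
holds for the regret since `|b_iᵀ μ| ≤ C / √lam` (`trivial_regret_le`).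
-/

namespace SpectralTS

/-! ### Quadratic forms of positive definite matrices -/

section LinearAlgebra

variable {ι : Type*} [Fintype ι]

lemma dotProduct_mulVec_comm {M : Matrix ι ι ℝ} (hM : M.IsHermitian) (x y : ι → ℝ) :
    x ⬝ᵥ (M *ᵥ y) = y ⬝ᵥ (M *ᵥ x) := by
  have hT : Mᵀ = M := by simpa using hM.eq
  rw [dotProduct_mulVec, ← mulVec_transpose, hT, dotProduct_comm]

lemma posSemidef_quadratic_nonneg {M : Matrix ι ι ℝ} (hM : M.PosSemidef) (x : ι → ℝ) :
    0 ≤ x ⬝ᵥ (M *ᵥ x) := by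
  simpa using hM.dotProduct_mulVec_nonneg x

lemma posDef_quadratic_pos {M : Matrix ι ι ℝ} (hM : M.PosDef) {x : ι → ℝ} (hx : x ≠ 0) :
    0 < x ⬝ᵥ (M *ᵥ x) := by
  simpa using hM.dotProduct_mulVec_pos hx

lemma sq_dotProduct_mulVec_le {M : Matrix ι ι ℝ} (hM : M.PosSemidef) (x y : ι → ℝ) :
    (x ⬝ᵥ (M *ᵥ y)) ^ 2 ≤ (x ⬝ᵥ (M *ᵥ x)) * (y ⬝ᵥ (M *ᵥ y)) := by
  have h : ∀ t : ℝ, 0 ≤ (y ⬝ᵥ (M *ᵥ y)) * (t * t) + (2 * (x ⬝ᵥ (M *ᵥ y))) * t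
      + x ⬝ᵥ (M *ᵥ x) := by
    intro t
    have h0 := posSemidef_quadratic_nonneg hM (x + t • y)
    simp only [mulVec_add, mulVec_smul, add_dotProduct, dotProduct_add, smul_dotProduct,
      dotProduct_smul, smul_eq_mul] at h0
    rw [dotProduct_mulVec_comm hM.isHermitian y x] at h0
    linarith
  have := discrim_le_zero h
  unfold discrim at this
  nlinarith

variable [DecidableEq ι]

lemma det_add_vecMulVec_self {M : Matrix ι ι ℝ} (hM : M.PosDef) (b : ι → ℝ) :
    (M + vecMulVec b b).det = M.det * (1 + b ⬝ᵥ (M⁻¹ *ᵥ b)) := by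
  have hu : IsUnit M.det := (Matrix.isUnit_iff_isUnit_det M).1 hM.isUnit
  rw [vecMulVec_eq Unit, det_add_replicateCol_mul_replicateRow hu, det_unique (n := Unit),
    dotProduct_mulVec]
  simp [Matrix.mul_apply, vecMul, dotProduct]

/-- The effect of a rank-one update of `M` and of a shift of `S` along the same vector on the
quadratic form of the inverse (a consequence of the Sherman-Morrison formula). -/
lemma quadratic_inv_add_vecMulVec {M : Matrix ι ι ℝ} (hM : M.PosDef) (b S : ι → ℝ) (x : ℝ) :
    (S + x • b) ⬝ᵥ ((M + vecMulVec b b)⁻¹ *ᵥ (S + x • b)) =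
      S ⬝ᵥ (M⁻¹ *ᵥ S) + (2 * x * (b ⬝ᵥ (M⁻¹ *ᵥ S)) + x ^ 2 * (b ⬝ᵥ (M⁻¹ *ᵥ b))
        - (b ⬝ᵥ (M⁻¹ *ᵥ S)) ^ 2) / (1 + b ⬝ᵥ (M⁻¹ *ᵥ b)) := by
  have hu : IsUnit M.det := (Matrix.isUnit_iff_isUnit_det M).1 hM.isUnit
  have hq : 0 ≤ b ⬝ᵥ (M⁻¹ *ᵥ b) := posSemidef_quadratic_nonneg hM.inv.posSemidef b
  have hq1 : 1 + b ⬝ᵥ (M⁻¹ *ᵥ b) ≠ 0 := by positivity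
  have hu' : IsUnit (M + vecMulVec b b).det := by
    rw [det_add_vecMulVec_self hM]
    exact isUnit_iff_ne_zero.2 (mul_ne_zero hu.ne_zero hq1)
  have hMi : ∀ z, M *ᵥ (M⁻¹ *ᵥ z) = z := fun z => by
    rw [mulVec_mulVec, mul_nonsing_inv _ hu, one_mulVec]
  -- The solution of `(M + b bᵀ) z = y` is read off from `M⁻¹ y` and `M⁻¹ b`.
  have key : ∀ y : ι → ℝ, (M + vecMulVec b b)⁻¹ *ᵥ y
      = M⁻¹ *ᵥ y - ((b ⬝ᵥ (M⁻¹ *ᵥ y)) / (1 + b ⬝ᵥ (M⁻¹ *ᵥ b))) • (M⁻¹ *ᵥ b) := by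
    intro y
    have h1 : (M + vecMulVec b b) *ᵥ
        (M⁻¹ *ᵥ y - ((b ⬝ᵥ (M⁻¹ *ᵥ y)) / (1 + b ⬝ᵥ (M⁻¹ *ᵥ b))) • (M⁻¹ *ᵥ b)) = y := by
      rw [add_mulVec, mulVec_sub, mulVec_smul, hMi, hMi, mulVec_sub, mulVec_smul,
        vecMulVec_mulVec, vecMulVec_mulVec]
      ext i
      simp
      field_simp
      ring
    conv_lhs => rw [← h1]
    rw [mulVec_mulVec, nonsing_inv_mul _ hu', one_mulVec]
  rw [key]
  simp only [mulVec_add, mulVec_smul, add_dotProduct, dotProduct_add, smul_dotProduct,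
    dotProduct_smul, smul_eq_mul, dotProduct_sub]
  rw [dotProduct_mulVec_comm hM.inv.isHermitian S b]
  field_simp
  ring

lemma det_le_exp_trace_sub_card {M : Matrix ι ι ℝ} (hM : M.PosDef) :
    M.det ≤ Real.exp (M.trace - Fintype.card ι) := by
  rw [hM.isHermitian.det_eq_prod_eigenvalues, hM.isHermitian.trace_eq_sum_eigenvalues]
  simp only [RCLike.ofReal_real_eq_id, id]
  have : ∑ i, hM.isHermitian.eigenvalues i - (Fintype.card ι : ℝ)
      = ∑ i, (hM.isHermitian.eigenvalues i - 1) := by simp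
  rw [this, Real.exp_sum]
  exact prod_le_prod (fun i _ => (hM.eigenvalues_pos i).le)
    (fun i _ => by linarith [Real.add_one_le_exp (hM.isHermitian.eigenvalues i - 1)])

/-- Hadamard's inequality. -/
lemma det_le_prod_diag {M : Matrix ι ι ℝ} (hM : M.PosDef) : M.det ≤ ∏ i, M i i := by
  have hpos : ∀ i, 0 < M i i := fun i => hM.diag_pos
  set w : ι → ℝ := fun i => (√(M i i))⁻¹ with hw
  have hw0 : ∀ i, 0 < w i := fun i => inv_pos.2 (Real.sqrt_pos.2 (hpos i))
  have hww : ∀ i, w i * w i = (M i i)⁻¹ := fun i => by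
    rw [hw, ← mul_inv, Real.mul_self_sqrt (hpos i).le]
  have hD : (diagonal w)ᴴ * M * diagonal w = diagonal w * M * diagonal w := by
    rw [diagonal_conjTranspose]; simp
  have hN : (diagonal w * M * diagonal w).PosDef := by
    rw [← hD]
    refine hM.conjTranspose_mul_mul_same ?_
    intro x y hxy
    ext i
    have := congrFun hxy i
    simp only [mulVec_diagonal] at this
    exact mul_left_cancel₀ (hw0 i).ne' this
  have h1 := det_le_exp_trace_sub_card hN
  have htr : (diagonal w * M * diagonal w).trace = Fintype.card ι := by
    simp only [trace, diag_apply, mul_diagonal, diagonal_mul]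
    have : ∀ i, w i * M i i * w i = 1 := fun i => by
      rw [mul_right_comm, hww, inv_mul_cancel₀ (hpos i).ne']
    simp [this]
  rw [htr, sub_self, Real.exp_zero, det_mul, det_mul, det_diagonal, mul_right_comm,
    ← prod_mul_distrib, prod_congr rfl (fun i _ => hww i), prod_inv_distrib] at h1
  rwa [inv_mul_le_iff₀ (prod_pos fun i _ => hpos i), mul_one] at h1

end LinearAlgebra

/-! ### The design matrices along a fixed sequence of arms -/

section Design

variable {N : ℕ} {W Q : Matrix (Fin N) (Fin N) ℝ} {ev : Fin N → ℝ} {lam : ℝ}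

lemma laplacian_quadratic_nonneg (hsymm : W.IsSymm) (hW : ∀ i j, 0 ≤ W i j) (x : Fin N → ℝ) :
    0 ≤ x ⬝ᵥ (laplacian W *ᵥ x) := by
  have h1 : x ⬝ᵥ (laplacian W *ᵥ x)
      = ∑ i, ∑ j, W i j * (x i * x i) - ∑ i, ∑ j, W i j * (x i * x j) := by
    rw [laplacian, sub_mulVec, dotProduct_sub]
    simp only [dotProduct, mulVec_diagonal, mul_sum, sum_mul]
    simp only [mulVec, dotProduct, mul_sum]
    congr 1 <;> exact sum_congr rfl fun i _ => sum_congr rfl fun j _ => by ring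
  have h2 : ∑ i, ∑ j, W i j * (x i * x i) = ∑ i, ∑ j, W i j * (x j * x j) := by
    rw [sum_comm]
    exact sum_congr rfl fun i _ => sum_congr rfl fun j _ => by rw [hsymm.apply]
  have h3 : 0 ≤ ∑ i, ∑ j, W i j * (x i - x j) ^ 2 :=
    sum_nonneg fun i _ => sum_nonneg fun j _ => mul_nonneg (hW i j) (sq_nonneg _)
  have h4 : ∑ i, ∑ j, W i j * (x i - x j) ^ 2 = ∑ i, ∑ j, W i j * (x i * x i)
      + ∑ i, ∑ j, W i j * (x j * x j) - 2 * ∑ i, ∑ j, W i j * (x i * x j) := by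
    simp only [mul_sum, ← sum_add_distrib, ← sum_sub_distrib]
    exact sum_congr rfl fun i _ => sum_congr rfl fun j _ => by ring
  linarith

lemma IsSpectralBasis.ev_nonneg (h : IsSpectralBasis W Q ev) (i : Fin N) : 0 ≤ ev i := by
  have hQ : Qᵀ * Q = 1 := by
    simpa [star_eq_conjTranspose] using (mem_unitaryGroup_iff'.1 h.orthogonal)
  have h1 : Qᵀ * laplacian W * Q = diagonal ev := by
    rw [h.decomposition]
    calc Qᵀ * (Q * diagonal ev * Qᵀ) * Q = (Qᵀ * Q) * diagonal ev * (Qᵀ * Q) := by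
          simp only [Matrix.mul_assoc]
      _ = diagonal ev := by rw [hQ]; simp
  have h2 := laplacian_quadratic_nonneg h.symm h.nonneg (fun j => Q j i)
  have h3 : (fun j => Q j i) ⬝ᵥ (laplacian W *ᵥ (fun j => Q j i)) = ev i := by
    have := congrFun (congrFun h1 i) i
    rw [diagonal_apply_eq, Matrix.mul_assoc] at this
    rw [← this]
    simp [Matrix.mul_apply, dotProduct, mulVec]
  rwa [h3] at h2

lemma IsSpectralBasis.row_dotProduct_self (h : IsSpectralBasis W Q ev) (i : Fin N) :
    Q i ⬝ᵥ Q i = 1 := by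
  have hQ : Q * Qᵀ = 1 := by
    simpa [star_eq_conjTranspose] using (mem_unitaryGroup_iff.1 h.orthogonal)
  have := congrFun (congrFun hQ i) i
  simpa [Matrix.mul_apply, dotProduct] using this

lemma regSpectrum_eq_diagonal : regSpectrum ev lam = diagonal (fun i => ev i + lam) := by
  rw [regSpectrum, smul_one_eq_diagonal, diagonal_add]

lemma regSpectrum_posDef (hlam : 0 < lam) (hev : ∀ i, 0 ≤ ev i) :
    (regSpectrum ev lam).PosDef := by
  rw [regSpectrum_eq_diagonal]
  exact PosDef.diagonal fun i => by linarith [hev i]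

lemma posSemidef_sum_vecMulVec (a : ℕ → Fin N) (t : ℕ) :
    (∑ τ ∈ range t, vecMulVec (Q (a τ)) (Q (a τ))).PosSemidef :=
  posSemidef_sum _ fun τ _ => by simpa using posSemidef_vecMulVec_self_star (Q (a τ))

lemma designMatrix_posDef (hlam : 0 < lam) (hev : ∀ i, 0 ≤ ev i) (a : ℕ → Fin N) (t : ℕ) :
    (designMatrix Q ev lam a t).PosDef :=
  (regSpectrum_posDef hlam hev).add_posSemidef (posSemidef_sum_vecMulVec a t)

lemma designMatrix_zero (a : ℕ → Fin N) : designMatrix Q ev lam a 0 = regSpectrum ev lam := by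
  simp [designMatrix]

lemma designMatrix_succ (a : ℕ → Fin N) (t : ℕ) :
    designMatrix Q ev lam a (t + 1)
      = designMatrix Q ev lam a t + vecMulVec (Q (a t)) (Q (a t)) := by
  rw [designMatrix, designMatrix, sum_range_succ, add_assoc]

lemma regSpectrum_quadratic_le (a : ℕ → Fin N) (t : ℕ) (z : Fin N → ℝ) :
    z ⬝ᵥ (regSpectrum ev lam *ᵥ z) ≤ z ⬝ᵥ (designMatrix Q ev lam a t *ᵥ z) := by
  rw [designMatrix, add_mulVec, dotProduct_add]
  linarith [posSemidef_quadratic_nonneg (posSemidef_sum_vecMulVec (Q := Q) a t) z]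

lemma lam_mul_dotProduct_le (hev : ∀ i, 0 ≤ ev i) (z : Fin N → ℝ) :
    lam * (z ⬝ᵥ z) ≤ z ⬝ᵥ (regSpectrum ev lam *ᵥ z) := by
  rw [regSpectrum_eq_diagonal]
  simp only [dotProduct, mulVec_diagonal, mul_sum]
  refine sum_le_sum fun i _ => ?_
  nlinarith [mul_nonneg (hev i) (mul_self_nonneg (z i))]

/-- The squared width `‖b‖²_{B⁻¹}` of a unit vector is at most `1 / lam`. -/
lemma inv_quadratic_le (hlam : 0 < lam) (hev : ∀ i, 0 ≤ ev i) (a : ℕ → Fin N) (t : ℕ)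
    {b : Fin N → ℝ} (hb : b ⬝ᵥ b = 1) :
    b ⬝ᵥ ((designMatrix Q ev lam a t)⁻¹ *ᵥ b) ≤ 1 / lam := by
  have hD := designMatrix_posDef (Q := Q) hlam hev a t
  have hu := (Matrix.isUnit_iff_isUnit_det _).1 hD.isUnit
  set D := designMatrix Q ev lam a t
  set z := D⁻¹ *ᵥ b with hz
  have hDz : D *ᵥ z = b := by rw [hz, mulVec_mulVec, mul_nonsing_inv _ hu, one_mulVec]
  have h1 : lam * (z ⬝ᵥ z) ≤ b ⬝ᵥ z := by
    have := (lam_mul_dotProduct_le hev z).trans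
      (regSpectrum_quadratic_le (Q := Q) (lam := lam) a t z)
    change _ ≤ z ⬝ᵥ (D *ᵥ z) at this
    rwa [hDz, dotProduct_comm z b] at this
  have h2 : (b ⬝ᵥ z) ^ 2 ≤ z ⬝ᵥ z := by
    have := sq_dotProduct_mulVec_le (M := (1 : Matrix (Fin N) (Fin N) ℝ)) PosSemidef.one b z
    simpa [hb] using this
  rw [le_div_iff₀ hlam]
  have h0 : 0 ≤ b ⬝ᵥ z := posSemidef_quadratic_nonneg hD.inv.posSemidef b
  by_contra hcon
  push Not at hcon
  have h3 : lam * (b ⬝ᵥ z) ^ 2 ≤ b ⬝ᵥ z := (mul_le_mul_of_nonneg_left h2 hlam.le).trans h1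
  have h4 : 0 < b ⬝ᵥ z := pos_of_mul_pos_left (one_pos.trans hcon) hlam.le
  nlinarith [mul_pos h4 (sub_pos.2 hcon)]

lemma abs_dotProduct_le_matNorm (hlam : 0 < lam) (hev : ∀ i, 0 ≤ ev i) {b : Fin N → ℝ}
    (hb : b ⬝ᵥ b = 1) (mu : Fin N → ℝ) :
    |b ⬝ᵥ mu| ≤ matNorm (regSpectrum ev lam) mu / √lam := by
  rw [matNorm, ← Real.sqrt_div' _ hlam.le]
  refine Real.abs_le_sqrt ?_
  rw [le_div_iff₀ hlam]
  have h := sq_dotProduct_mulVec_le (M := (1 : Matrix (Fin N) (Fin N) ℝ)) PosSemidef.one b mu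
  simp only [one_mulVec, hb, one_mul] at h
  nlinarith [lam_mul_dotProduct_le (lam := lam) hev mu]

lemma designMatrix_mulVec (a : ℕ → Fin N) (t : ℕ) (mu : Fin N → ℝ) :
    designMatrix Q ev lam a t *ᵥ mu = regSpectrum ev lam *ᵥ mu
      + ∑ τ ∈ range t, (Q (a τ) ⬝ᵥ mu) • Q (a τ) := by
  rw [designMatrix, add_mulVec, sum_mulVec]
  simp [vecMulVec_mulVec]

/-- The estimation error in the direction `b` splits into the contribution of the noise and
that of the regularization. -/
lemma abs_estimate_error_le (hlam : 0 < lam) (hev : ∀ i, 0 ≤ ev i) (a : ℕ → Fin N) (r : ℕ → ℝ)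
    (t : ℕ) (mu b : Fin N → ℝ) :
    |b ⬝ᵥ estimate Q ev lam a r t - b ⬝ᵥ mu| ≤
      matNorm (designMatrix Q ev lam a t)⁻¹ b *
        (matNorm (designMatrix Q ev lam a t)⁻¹
          (∑ τ ∈ range t, (r τ - Q (a τ) ⬝ᵥ mu) • Q (a τ)) + matNorm (regSpectrum ev lam) mu) := by
  have hD := designMatrix_posDef (Q := Q) hlam hev a t
  have hu := (Matrix.isUnit_iff_isUnit_det _).1 hD.isUnit
  have hmul := designMatrix_mulVec (Q := Q) (ev := ev) (lam := lam) a t mu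
  have hle := regSpectrum_quadratic_le (Q := Q) (ev := ev) (lam := lam) a t
  have hest : estimate Q ev lam a r t
      = (designMatrix Q ev lam a t)⁻¹ *ᵥ (∑ τ ∈ range t, r τ • Q (a τ)) := rfl
  set D := designMatrix Q ev lam a t
  set L := regSpectrum ev lam with hL
  set S := ∑ τ ∈ range t, (r τ - Q (a τ) ⬝ᵥ mu) • Q (a τ) with hS
  have hsplit : b ⬝ᵥ estimate Q ev lam a r t - b ⬝ᵥ mu
      = b ⬝ᵥ (D⁻¹ *ᵥ S) - b ⬝ᵥ (D⁻¹ *ᵥ (L *ᵥ mu)) := by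
    have h1 : ∑ τ ∈ range t, r τ • Q (a τ) = S + (D *ᵥ mu - L *ᵥ mu) := by
      rw [hmul, hS, add_sub_cancel_left, ← sum_add_distrib]
      exact sum_congr rfl fun τ _ => by rw [← add_smul, sub_add_cancel]
    rw [hest, h1, mulVec_add, mulVec_sub, mulVec_mulVec, nonsing_inv_mul _ hu, one_mulVec,
      dotProduct_add, dotProduct_sub]
    ring
  have h1 : |b ⬝ᵥ (D⁻¹ *ᵥ S)| ≤ matNorm D⁻¹ b * matNorm D⁻¹ S := by
    rw [matNorm, matNorm, ← Real.sqrt_mul (posSemidef_quadratic_nonneg hD.inv.posSemidef b)]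
    exact Real.abs_le_sqrt (sq_dotProduct_mulVec_le hD.inv.posSemidef b S)
  have h2 : |b ⬝ᵥ (D⁻¹ *ᵥ (L *ᵥ mu))| ≤ matNorm D⁻¹ b * matNorm L mu := by
    have hLp : L.PosDef := regSpectrum_posDef hlam hev
    rw [matNorm, matNorm, ← Real.sqrt_mul (posSemidef_quadratic_nonneg hD.inv.posSemidef b)]
    refine Real.abs_le_sqrt ((sq_dotProduct_mulVec_le hD.inv.posSemidef b _).trans ?_)
    refine mul_le_mul_of_nonneg_left ?_ (posSemidef_quadratic_nonneg hD.inv.posSemidef b)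
    -- With `y = D⁻¹ L mu`, the claim `‖y‖_D ≤ ‖mu‖_L` follows from Cauchy-Schwarz for `L ≤ D`.
    set y := D⁻¹ *ᵥ (L *ᵥ mu) with hy
    have hDy : D *ᵥ y = L *ᵥ mu := by rw [hy, mulVec_mulVec, mul_nonsing_inv _ hu, one_mulVec]
    have e1 : (L *ᵥ mu) ⬝ᵥ y = y ⬝ᵥ (D *ᵥ y) := by rw [hDy, dotProduct_comm]
    have e2 : (y ⬝ᵥ (D *ᵥ y)) ^ 2 ≤ (y ⬝ᵥ (L *ᵥ y)) * (mu ⬝ᵥ (L *ᵥ mu)) := by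
      rw [hDy]; exact sq_dotProduct_mulVec_le hLp.posSemidef y mu
    have e3 := hle y
    have e4 := posSemidef_quadratic_nonneg hLp.posSemidef y
    have e5 := posSemidef_quadratic_nonneg hLp.posSemidef mu
    rw [e1]
    by_contra hcon
    push Not at hcon
    nlinarith
  rw [hsplit, mul_add]
  exact (abs_sub _ _).trans (add_le_add h1 h2)

lemma designMatrix_diag (a : ℕ → Fin N) (t : ℕ) (i : Fin N) :
    designMatrix Q ev lam a t i i = ev i + lam + ∑ τ ∈ range t, Q (a τ) i ^ 2 := by
  rw [designMatrix, regSpectrum_eq_diagonal, Matrix.add_apply, diagonal_apply_eq,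
    Matrix.sum_apply]
  simp [vecMulVec_apply, sq]

lemma effDim_le (T : ℕ) : effDim ev lam T ≤ N :=
  Finset.sup_le fun i _ => i.isLt

lemma one_le_effDim (i₀ : Fin N) (hlam : 0 < lam) {T : ℕ} : 1 ≤ effDim ev lam T := by
  have hN : 0 < N := i₀.pos
  refine le_trans ?_ (Finset.le_sup (f := fun i : Fin N => (i : ℕ) + 1) (b := ⟨0, hN⟩) ?_)
  · simp
  · simp only [mem_filter, mem_univ, true_and, Nat.cast_zero, zero_mul]
    exact div_nonneg (by positivity) (Real.log_nonneg (by
      have : 0 ≤ (T : ℝ) / lam := by positivity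
      linarith))

lemma div_log_lt_of_effDim_lt {T : ℕ} (h : effDim ev lam T < N) :
    (T : ℝ) / Real.log (1 + T / lam)
      < effDim ev lam T * (ev ⟨effDim ev lam T, h⟩ + lam) := by
  by_contra hcon
  push Not at hcon
  have h1 : (⟨effDim ev lam T, h⟩ : Fin N) ∈ univ.filter (fun i : Fin N =>
      (i : ℝ) * (ev i + lam) ≤ (T : ℝ) / Real.log (1 + (T : ℝ) / lam)) := by
    simpa using hcon
  have h2 : effDim ev lam T + 1 ≤ effDim ev lam T := by
    conv_rhs => rw [effDim]
    exact Finset.le_sup (f := fun i : Fin N => (i : ℕ) + 1) h1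
  omega

/-- The information gain is controlled by the effective dimension `d`: the first `d` coordinates
contribute at most `log (1 + T / lam)` each, and the tail at most `T / λ_{d+1}` in total. -/
lemma log_det_designMatrix_le (hlam : 0 < lam) (hev : ∀ i, 0 ≤ ev i) (hmono : Monotone ev)
    (hQ : ∀ i, Q i ⬝ᵥ Q i = 1) {T : ℕ} (hT : 1 ≤ T) (a : ℕ → Fin N) {t : ℕ} (ht : t ≤ T) :
    Real.log ((designMatrix Q ev lam a t).det / (regSpectrum ev lam).det)
      ≤ 2 * effDim ev lam T * Real.log (1 + T / lam) := by
  have hD := designMatrix_posDef (Q := Q) hlam hev a t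
  have hΛ := regSpectrum_posDef (ev := ev) hlam hev
  have hl : ∀ i, 0 < ev i + lam := fun i => by linarith [hev i]
  have hT0 : (0 : ℝ) < T := by exact_mod_cast hT
  set d := effDim ev lam T with hd
  set L := Real.log (1 + T / lam) with hL
  have hL0 : 0 < L := Real.log_pos (by have : 0 < (T : ℝ) / lam := by positivity
                                       linarith)
  set c : Fin N → ℝ := fun i => ∑ τ ∈ range t, Q (a τ) i ^ 2 with hc
  have hc0 : ∀ i, 0 ≤ c i := fun i => sum_nonneg fun _ _ => sq_nonneg _
  have hcsum : ∑ i, c i ≤ T := by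
    rw [hc, sum_comm]
    have : ∀ τ, ∑ i, Q (a τ) i ^ 2 = 1 := fun τ => by
      rw [← hQ (a τ)]; simp [dotProduct, sq]
    simp only [this, sum_const, card_range, nsmul_eq_mul, mul_one]
    exact_mod_cast ht
  have hcT : ∀ i, c i ≤ T := fun i =>
    (single_le_sum (f := c) (fun j _ => hc0 j) (mem_univ i)).trans hcsum
  have h1 : Real.log ((designMatrix Q ev lam a t).det / (regSpectrum ev lam).det)
      ≤ ∑ i, Real.log (1 + c i / (ev i + lam)) := by
    rw [← Real.log_prod (fun i _ => by have := hc0 i; have := hl i; positivity)]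
    refine Real.log_le_log (div_pos hD.det_pos hΛ.det_pos) ?_
    rw [div_le_iff₀ hΛ.det_pos]
    refine (det_le_prod_diag hD).trans (le_of_eq ?_)
    rw [regSpectrum_eq_diagonal, det_diagonal, ← prod_mul_distrib]
    refine prod_congr rfl fun i _ => ?_
    rw [designMatrix_diag]
    have := (hl i).ne'
    field_simp
    rfl
  have hterm : ∀ i : Fin N, Real.log (1 + c i / (ev i + lam)) ≤
      (if (i : ℕ) < d then L else 0) + c i * (d * L / T) := by
    intro i
    have hci : 0 ≤ c i / (ev i + lam) := div_nonneg (hc0 i) (hl i).le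
    have hpos : 0 ≤ c i * (d * L / T) := mul_nonneg (hc0 i) (by positivity)
    split_ifs with hi
    · have : Real.log (1 + c i / (ev i + lam)) ≤ L := by
        refine Real.log_le_log (by linarith) ?_
        have := div_le_div₀ hT0.le (hcT i) hlam (by linarith [hev i] : lam ≤ ev i + lam)
        linarith
      linarith
    · have hdN : d < N := lt_of_le_of_lt (not_lt.1 hi) i.isLt
      have h3 := div_log_lt_of_effDim_lt (ev := ev) (lam := lam) (T := T) hdN
      have h4 : ev ⟨d, hdN⟩ ≤ ev i := hmono (by simpa [Fin.le_def] using not_lt.1 hi)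
      have h5 : (T : ℝ) ≤ d * L * (ev i + lam) := by
        rw [← hL, div_lt_iff₀ hL0] at h3
        have : (d : ℝ) * (ev ⟨d, hdN⟩ + lam) * L ≤ d * (ev i + lam) * L := by gcongr
        linarith
      have h6 : 1 / (ev i + lam) ≤ d * L / T := by
        rw [div_le_div_iff₀ (hl i) hT0]; linarith
      have h7 := Real.log_le_sub_one_of_pos (by linarith : 0 < 1 + c i / (ev i + lam))
      have h8 : c i / (ev i + lam) ≤ c i * (d * L / T) := by
        rw [div_eq_mul_one_div]; exact mul_le_mul_of_nonneg_left h6 (hc0 i)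
      linarith
  have hcount : ∑ i : Fin N, (if (i : ℕ) < d then L else 0) = d * L := by
    rw [← sum_filter, sum_const, nsmul_eq_mul]
    congr 2
    rw [Fin.card_filter_val_lt, min_eq_right (effDim_le T)]
  calc _ ≤ ∑ i, Real.log (1 + c i / (ev i + lam)) := h1
    _ ≤ ∑ i : Fin N, ((if (i : ℕ) < d then L else 0) + c i * (d * L / T)) :=
        sum_le_sum fun i _ => hterm i
    _ = d * L + (∑ i, c i) * (d * L / T) := by rw [sum_add_distrib, hcount, sum_mul]
    _ ≤ d * L + T * (d * L / T) := by
        gcongr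
    _ = 2 * d * L := by field_simp; ring

/-- The elliptical potential lemma. -/
lemma sum_sq_width_le (hlam : 0 < lam) (hev : ∀ i, 0 ≤ ev i)
    (hQ : ∀ i, Q i ⬝ᵥ Q i = 1) (a : ℕ → Fin N) (T : ℕ) :
    ∑ t ∈ range T, Q (a t) ⬝ᵥ ((designMatrix Q ev lam a t)⁻¹ *ᵥ Q (a t)) ≤
      (1 + lam) / lam *
        Real.log ((designMatrix Q ev lam a T).det / (regSpectrum ev lam).det) := by
  have hΛ := regSpectrum_posDef (ev := ev) hlam hev
  induction T with
  | zero => simp [designMatrix_zero, div_self hΛ.det_pos.ne']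
  | succ T ih =>
    have hD := designMatrix_posDef (Q := Q) hlam hev a T
    rw [sum_range_succ, designMatrix_succ, det_add_vecMulVec_self hD, mul_div_right_comm]
    have hw := inv_quadratic_le (Q := Q) hlam hev a T (hQ (a T))
    have h0 : 0 ≤ Q (a T) ⬝ᵥ ((designMatrix Q ev lam a T)⁻¹ *ᵥ Q (a T)) :=
      posSemidef_quadratic_nonneg hD.inv.posSemidef _
    set w := Q (a T) ⬝ᵥ ((designMatrix Q ev lam a T)⁻¹ *ᵥ Q (a T))
    rw [Real.log_mul (div_pos hD.det_pos hΛ.det_pos).ne' (by positivity), mul_add]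
    refine add_le_add ih ?_
    have h1 : w / (1 + w) ≤ Real.log (1 + w) := by
      have := Real.one_sub_inv_le_log_of_pos (by linarith : 0 < 1 + w)
      have e : w / (1 + w) = 1 - (1 + w)⁻¹ := by field_simp; ring
      rwa [e]
    have h2 : 1 + w ≤ (1 + lam) / lam := by
      have : (1 + lam) / lam = 1 + 1 / lam := by field_simp; ring
      rw [this]; linarith
    calc w = (1 + w) * (w / (1 + w)) := by field_simp
      _ ≤ (1 + lam) / lam * Real.log (1 + w) := by gcongr

end Design

/-! ### Gaussian estimates -/

section Gaussian

open scoped NNReal ENNReal RealInnerProductSpace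

/-- The law of a linear functional under a multivariate Gaussian distribution. -/
lemma multivariateGaussian_map_dotProduct {N : ℕ} (m : EuclideanSpace ℝ (Fin N))
    {S : Matrix (Fin N) (Fin N) ℝ} (hS : S.PosSemidef) (b : Fin N → ℝ) :
    (multivariateGaussian m S).map (fun x => b ⬝ᵥ x.ofLp)
      = gaussianReal (b ⬝ᵥ m.ofLp) (b ⬝ᵥ (S *ᵥ b)).toNNReal := by
  set L : StrongDual ℝ (EuclideanSpace ℝ (Fin N)) := innerSL ℝ (WithLp.toLp 2 b) with hL
  have hLx : ∀ x : EuclideanSpace ℝ (Fin N), L x = b ⬝ᵥ x.ofLp := fun x => by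
    rw [hL, innerSL_apply_apply, PiLp.inner_apply]
    simp [dotProduct, mul_comm]
  have hfun : (fun x : EuclideanSpace ℝ (Fin N) => b ⬝ᵥ x.ofLp) = L := by
    ext x; exact (hLx x).symm
  have hmean : ∫ x, L x ∂multivariateGaussian m S = L (∫ x, x ∂multivariateGaussian m S) :=
    L.integral_comp_id_comm IsGaussian.integrable_id
  rw [hfun, IsGaussian.map_eq_gaussianReal, hmean, integral_id_multivariateGaussian, hLx]
  congr 2
  rw [← covariance_self (by fun_prop)]
  have h2 : (L : EuclideanSpace ℝ (Fin N) → ℝ) = fun x => ⟪WithLp.toLp 2 b, x⟫ := by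
    ext x; rw [hL, innerSL_apply_apply]
  rw [h2, ← covarianceBilin_apply_eq_cov IsGaussian.memLp_two_id,
    covarianceBilin_multivariateGaussian hS]

lemma gaussianReal_eq_map_std (m σ : ℝ) :
    gaussianReal m (σ ^ 2).toNNReal = (gaussianReal 0 1).map (fun z => m + σ * z) := by
  have h : (fun z : ℝ => m + σ * z) = (fun z => m + z) ∘ (fun z => σ * z) := rfl
  rw [h, ← Measure.map_map (by fun_prop) (by fun_prop), gaussianReal_map_const_mul,
    gaussianReal_map_const_add]
  congr 1
  · ring
  · ext; simp [Real.coe_toNNReal _ (sq_nonneg σ)]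

lemma le_gaussianReal_std_Ici_one :
    ENNReal.ofReal (1 / (4 * Real.exp 1 * √Real.pi)) ≤ gaussianReal 0 1 (Set.Ici 1) := by
  have h1 : ENNReal.ofReal (1 / (4 * Real.exp 1 * √Real.pi)) ≤
      ∫⁻ _ in Set.Icc (1 : ℝ) 2, ENNReal.ofReal (1 / (4 * Real.exp 1 * √Real.pi)) := by
    rw [setLIntegral_const, Real.volume_Icc]
    norm_num
  refine h1.trans ((setLIntegral_mono (measurable_gaussianPDF 0 1) ?_).trans ?_)
  · intro x hx
    refine ENNReal.ofReal_le_ofReal ?_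
    rw [gaussianPDFReal_def]
    simp only [NNReal.coe_one, mul_one, sub_zero]
    have hπ : 0 < √Real.pi := Real.sqrt_pos.2 Real.pi_pos
    have e2 : Real.exp (-2) ≤ Real.exp (-x ^ 2 / 2) := by
      apply Real.exp_le_exp.2; nlinarith [hx.1, hx.2]
    have e3 : Real.exp (-2) = 1 / (Real.exp 1 * Real.exp 1) := by
      rw [← Real.exp_add, one_div, ← Real.exp_neg]; norm_num
    have he := Real.exp_one_lt_d9
    have he0 := Real.exp_pos 1
    have hs2 : √2 ≤ 1.4143 := Real.sqrt_le_iff.2 (by norm_num)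
    rw [Real.sqrt_mul (by norm_num)]
    refine le_trans ?_ (mul_le_mul_of_nonneg_left e2 (by positivity))
    rw [e3, inv_mul_eq_div, div_div, div_le_div_iff₀ (by positivity) (by positivity)]
    have h4 : Real.exp 1 * √2 ≤ 4 := by nlinarith [Real.sqrt_nonneg 2]
    have h5 : Real.exp 1 * √2 * (Real.exp 1 * √Real.pi) ≤ 4 * (Real.exp 1 * √Real.pi) := by
      gcongr
    linarith
  · rw [gaussianReal_apply 0 one_ne_zero]
    exact lintegral_mono_set (fun x hx => hx.1)

/-- Anti-concentration: with probability at least `1 / (4 e √π)`, a Gaussian variable exceeds its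
mean by at least one standard deviation. -/
lemma le_gaussianReal_Ici {m σ y : ℝ} (hy : y ≤ m + σ) (hσ : 0 ≤ σ) :
    ENNReal.ofReal (1 / (4 * Real.exp 1 * √Real.pi))
      ≤ gaussianReal m (σ ^ 2).toNNReal (Set.Ici y) := by
  rw [gaussianReal_eq_map_std, Measure.map_apply (by fun_prop) measurableSet_Ici]
  refine le_gaussianReal_std_Ici_one.trans (measure_mono fun z hz => ?_)
  simp only [Set.mem_preimage, Set.mem_Ici] at hz ⊢
  nlinarith

lemma gaussianReal_std_ge_le (β : ℝ) (hβ : 0 ≤ β) :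
    gaussianReal 0 1 (Set.Ici β) ≤ ENNReal.ofReal (Real.exp (-β ^ 2 / 2)) := by
  have h := measure_ge_le_exp_mul_mgf (μ := gaussianReal 0 1) (X := id) β hβ
    (integrable_exp_mul_gaussianReal β)
  rw [mgf_id_gaussianReal] at h
  rw [← ofReal_measureReal]
  refine ENNReal.ofReal_le_ofReal (le_trans h ?_)
  rw [← Real.exp_add]
  apply Real.exp_le_exp.2
  simp only [NNReal.coe_one]
  nlinarith

lemma gaussianReal_abs_gt_le {m σ β : ℝ} (hβ : 0 ≤ β) (hσ : 0 ≤ σ) :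
    gaussianReal m (σ ^ 2).toNNReal {x | β * σ < |x - m|}
      ≤ ENNReal.ofReal (2 * Real.exp (-β ^ 2 / 2)) := by
  have hmeas : MeasurableSet {x : ℝ | β * σ < |x - m|} :=
    measurableSet_lt measurable_const (by fun_prop)
  rw [gaussianReal_eq_map_std, Measure.map_apply (by fun_prop) hmeas]
  have hneg : gaussianReal 0 1 (Set.Iic (-β)) = gaussianReal 0 1 (Set.Ici β) := by
    conv_lhs => rw [← neg_zero, ← gaussianReal_map_neg]
    rw [Measure.map_apply measurable_neg measurableSet_Iic]
    congr 1
    ext z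
    simp
  have hsub : (fun z => m + σ * z) ⁻¹' {x | β * σ < |x - m|} ⊆ Set.Ici β ∪ Set.Iic (-β) := by
    intro z hz
    simp only [Set.mem_preimage, Set.mem_ofPred_eq, add_sub_cancel_left, abs_mul,
      abs_of_nonneg hσ] at hz
    have : β < |z| := lt_of_mul_lt_mul_left (by linarith) hσ
    rcases lt_abs.1 this with h | h
    · exact Or.inl h.le
    · exact Or.inr (by simp only [Set.mem_Iic]; linarith)
  refine (measure_mono hsub).trans ((measure_union_le _ _).trans ?_)
  rw [hneg, two_mul, ENNReal.ofReal_add (Real.exp_nonneg _) (Real.exp_nonneg _)]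
  exact add_le_add (gaussianReal_std_ge_le β hβ) (gaussianReal_std_ge_le β hβ)

/-- The exponential weight obtained by mixing `exp (x ξ - ξ² / 2)` over `ξ ∼ 𝒩(u, s)`. -/
lemma lintegral_exp_gaussianReal (x u : ℝ) {s : ℝ} (hs : 0 < s) :
    ∫⁻ ξ, ENNReal.ofReal (Real.exp (x * ξ - ξ ^ 2 / 2)) ∂gaussianReal u s.toNNReal
      = ENNReal.ofReal ((√(1 + s))⁻¹ *
          Real.exp ((2 * x * u + x ^ 2 * s - u ^ 2) / (1 + s) / 2)) := by
  have hs1 : 0 < 1 + s := by linarith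
  have hs' : s.toNNReal ≠ 0 := by simpa using hs
  have hv : (s / (1 + s)).toNNReal ≠ 0 := by
    have : 0 < s / (1 + s) := by positivity
    simpa using this
  rw [gaussianReal_of_var_ne_zero _ hs', lintegral_withDensity_eq_lintegral_mul _
    (measurable_gaussianPDF _ _) (by fun_prop)]
  have key : ∀ ξ, (gaussianPDF u s.toNNReal * fun ξ =>
      ENNReal.ofReal (Real.exp (x * ξ - ξ ^ 2 / 2))) ξ =
      ENNReal.ofReal ((√(1 + s))⁻¹ *
          Real.exp ((2 * x * u + x ^ 2 * s - u ^ 2) / (1 + s) / 2)) *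
        gaussianPDF ((x * s + u) / (1 + s)) (s / (1 + s)).toNNReal ξ := by
    intro ξ
    rw [Pi.mul_apply, gaussianPDF_def, gaussianPDF_def,
      ← ENNReal.ofReal_mul (gaussianPDFReal_nonneg _ _ _), ← ENNReal.ofReal_mul (by positivity)]
    congr 1
    rw [gaussianPDFReal_def, gaussianPDFReal_def]
    simp only [Real.coe_toNNReal _ hs.le,
      Real.coe_toNNReal _ (by positivity : 0 ≤ s / (1 + s))]
    rw [mul_assoc, ← Real.exp_add, mul_mul_mul_comm, ← Real.exp_add]
    congr 1
    · rw [← mul_inv, ← Real.sqrt_mul hs1.le]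
      congr 2
      field_simp
    · congr 1
      field_simp
      ring
  rw [lintegral_congr key, lintegral_const_mul _ (measurable_gaussianPDF _ _),
    lintegral_gaussianPDF_eq_one _ hv, mul_one]

/-- The method of mixtures in one dimension: a quadratic exponential moment of a law that is
`1`-sub-Gaussian. -/
lemma lintegral_exp_quadratic_le {κ : Measure ℝ} [SFinite κ]
    (hκ : ∀ ξ : ℝ, ∫⁻ x, ENNReal.ofReal (Real.exp (ξ * x)) ∂κ ≤
      ENNReal.ofReal (Real.exp (ξ ^ 2 / 2)))
    (u : ℝ) {s : ℝ} (hs : 0 < s) :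
    ∫⁻ x, ENNReal.ofReal (Real.exp ((2 * x * u + x ^ 2 * s - u ^ 2) / (1 + s) / 2)) ∂κ
      ≤ ENNReal.ofReal √(1 + s) := by
  have hpos : 0 < √(1 + s) := Real.sqrt_pos.2 (by linarith)
  have h1 : ∀ x, ENNReal.ofReal (Real.exp ((2 * x * u + x ^ 2 * s - u ^ 2) / (1 + s) / 2))
      = ENNReal.ofReal √(1 + s) * ∫⁻ ξ, ENNReal.ofReal (Real.exp (x * ξ - ξ ^ 2 / 2))
          ∂gaussianReal u s.toNNReal := fun x => by
    rw [lintegral_exp_gaussianReal x u hs, ← ENNReal.ofReal_mul hpos.le, ← mul_assoc,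
      mul_inv_cancel₀ hpos.ne', one_mul]
  rw [lintegral_congr h1, lintegral_const_mul' _ _ ENNReal.ofReal_ne_top,
    lintegral_lintegral_swap (by fun_prop)]
  suffices h : ∫⁻ ξ, ∫⁻ x, ENNReal.ofReal (Real.exp (x * ξ - ξ ^ 2 / 2)) ∂κ
      ∂gaussianReal u s.toNNReal ≤ 1 from mul_le_of_le_one_right' h
  calc _ ≤ ∫⁻ _, 1 ∂gaussianReal u s.toNNReal := ?_
    _ = 1 := by simp
  refine lintegral_mono fun ξ => ?_
  have h2 : ∀ x, ENNReal.ofReal (Real.exp (x * ξ - ξ ^ 2 / 2))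
      = ENNReal.ofReal (Real.exp (-(ξ ^ 2 / 2))) * ENNReal.ofReal (Real.exp (ξ * x)) := fun x => by
    rw [← ENNReal.ofReal_mul (Real.exp_nonneg _), ← Real.exp_add]
    congr 2
    ring
  rw [lintegral_congr h2, lintegral_const_mul' _ _ ENNReal.ofReal_ne_top]
  refine (mul_le_mul_right (hκ ξ) _).trans_eq ?_
  rw [← ENNReal.ofReal_mul (Real.exp_nonneg _), ← Real.exp_add]
  simp

end Gaussian

/-! ### Conditional laws and supermartingales -/

section Conditional

open scoped NNReal ENNReal

variable {Ω : Type*} {mΩ : MeasurableSpace Ω} {P : Measure Ω}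

/-- Ville's maximal inequality for a nonnegative supermartingale on a finite horizon. -/
lemma mul_measure_exists_ge_le {m : ℕ → MeasurableSpace Ω} {M : ℕ → Ω → ℝ≥0∞} {T : ℕ}
    (hm : ∀ n ≤ T, m n ≤ mΩ) (hmono : Monotone m) (hM : ∀ n ≤ T, Measurable[m n] (M n))
    (hsuper : ∀ n < T, ∀ G, MeasurableSet[m n] G →
      ∫⁻ ω in G, M (n + 1) ω ∂P ≤ ∫⁻ ω in G, M n ω ∂P) (c : ℝ≥0∞) :
    c * P {ω | ∃ n < T, c ≤ M n ω} ≤ ∫⁻ ω, M 0 ω ∂P := by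
  set G : ℕ → Set Ω := fun n => {ω | ∀ k < n, M k ω < c} with hGdef
  have hG : ∀ n ≤ T, MeasurableSet[m n] (G n) := by
    intro n hn
    have : G n = ⋂ k, ⋂ (_ : k < n), {ω | M k ω < c} := by ext; simp [hGdef]
    rw [this]
    refine MeasurableSet.iInter fun k => MeasurableSet.iInter fun hk => ?_
    exact hmono hk.le _ (hM k (hk.le.trans hn) measurableSet_Iio)
  have key : ∀ n ≤ T, c * P {ω | ∃ k < n, c ≤ M k ω} + ∫⁻ ω in G n, M n ω ∂P
      ≤ ∫⁻ ω, M 0 ω ∂P := by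
    intro n
    induction n with
    | zero => intro _; simp [hGdef]
    | succ n ih =>
      intro hn
      refine le_trans ?_ (ih (by omega))
      have hGn := hm n (by omega) _ (hG n (by omega))
      have hGn1 := hG (n + 1) hn
      have hlt : MeasurableSet {ω | M n ω < c} :=
        measurableSet_lt ((hM n (by omega)).mono (hm n (by omega)) le_rfl) measurable_const
      have hGsub : G n ∩ {ω | M n ω < c} = G (n + 1) := by
        ext ω
        simp only [hGdef, Set.mem_inter_iff, Set.mem_ofPred_eq, Nat.lt_succ_iff_lt_or_eq]
        constructor
        · rintro ⟨h1, h2⟩ k (hk | rfl)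
          exacts [h1 k hk, h2]
        · exact fun h => ⟨fun k hk => h k (Or.inl hk), h n (Or.inr rfl)⟩
      have hlast : ∫⁻ ω in G (n + 1), M (n + 1) ω ∂P ≤ ∫⁻ ω in G (n + 1), M n ω ∂P := by
        have hGm : MeasurableSet[m n] (G (n + 1)) := by
          rw [← hGsub]
          exact @MeasurableSet.inter _ (m n) _ _ (hG n (by omega))
            (hM n (by omega) measurableSet_Iio)
        exact hsuper n (by omega) _ hGm
      have hcross : c * P (G n \ {ω | M n ω < c}) ≤ ∫⁻ ω in G n \ {ω | M n ω < c}, M n ω ∂P := by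
        rw [← setLIntegral_const]
        refine setLIntegral_mono' (hGn.diff hlt) fun ω hω => ?_
        simpa using hω.2
      have hcup : P {ω | ∃ k < n + 1, c ≤ M k ω} ≤
          P {ω | ∃ k < n, c ≤ M k ω} + P (G n \ {ω | M n ω < c}) := by
        refine (measure_mono ?_).trans (measure_union_le _ _)
        rintro ω ⟨k, hk, hc⟩
        by_cases hex : ∃ k < n, c ≤ M k ω
        · exact Or.inl hex
        · push Not at hex
          refine Or.inr ⟨hex, ?_⟩
          rcases Nat.lt_succ_iff_lt_or_eq.1 hk with h | rfl
          · exact absurd hc (not_le.2 (hex k h))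
          · simpa using hc
      calc c * P {ω | ∃ k < n + 1, c ≤ M k ω} + ∫⁻ ω in G (n + 1), M (n + 1) ω ∂P
          ≤ c * (P {ω | ∃ k < n, c ≤ M k ω} + P (G n \ {ω | M n ω < c}))
            + ∫⁻ ω in G (n + 1), M n ω ∂P := by gcongr
        _ ≤ c * P {ω | ∃ k < n, c ≤ M k ω} + (∫⁻ ω in G n \ {ω | M n ω < c}, M n ω ∂P
            + ∫⁻ ω in G n ∩ {ω | M n ω < c}, M n ω ∂P) := by
            rw [mul_add, add_assoc, hGsub]; gcongr
        _ = c * P {ω | ∃ k < n, c ≤ M k ω} + ∫⁻ ω in G n, M n ω ∂P := by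
            rw [add_comm (∫⁻ ω in G n \ _, M n ω ∂P), lintegral_inter_add_sdiff _ _ hlt]
  exact le_self_add.trans (key T le_rfl)

variable [IsProbabilityMeasure P]

lemma exists_condLaw_of_comap {E β : Type*} [MeasurableSpace E] [StandardBorelSpace E] [Nonempty E]
    {mβ : MeasurableSpace β} {X : Ω → β} (hX : Measurable X) {Y : Ω → E} (hY : Measurable Y) :
    ∃ κ : β → Measure E, (∀ b, IsProbabilityMeasure (κ b)) ∧
      (∀ f : β × E → ℝ≥0∞, Measurable f →
        ∫⁻ ω, f (X ω, Y ω) ∂P = ∫⁻ ω, ∫⁻ y, f (X ω, y) ∂κ (X ω) ∂P) ∧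
      (∀ S, MeasurableSet S → (fun ω => (κ (X ω)).real S) =ᵐ[P] P⟦Y ⁻¹' S | mβ.comap X⟧) ∧
      (∀ f : E → ℝ, Measurable f → Integrable (fun ω => f (Y ω)) P →
        (∀ᵐ ω ∂P, Integrable f (κ (X ω))) ∧
          P[fun ω => f (Y ω) | mβ.comap X] =ᵐ[P] fun ω => ∫ y, f y ∂κ (X ω)) := by
  refine ⟨fun b => condDistrib Y X P b, fun b => inferInstance, ?_, ?_, ?_⟩
  · intro f hf
    rw [← lintegral_map hf (hX.prodMk hY), ← compProd_map_condDistrib hY.aemeasurable,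
      Measure.lintegral_compProd hf, lintegral_map (Measurable.lintegral_kernel_prod_right' hf) hX]
  · exact fun S hS => condDistrib_ae_eq_condExp hX hY hS
  · intro f hf hint
    refine ⟨?_, condExp_ae_eq_integral_condDistrib hX hY.aemeasurable hf.stronglyMeasurable hint⟩
    have hi : Integrable (fun z : β × E => f z.2) (P.map fun ω => (X ω, Y ω)) :=
      (integrable_map_measure (hf.comp measurable_snd).aestronglyMeasurable
        (hX.prodMk hY).aemeasurable).2 hint
    exact hi.condDistrib_ae hX.aemeasurable hY.aemeasurable

/-- A regular conditional law `κ` of `Y` given the σ-algebra `m`, with the disintegration formula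
and its relation to conditional expectations. -/
lemma exists_condLaw {E : Type*} [MeasurableSpace E] [StandardBorelSpace E] [Nonempty E]
    {m : MeasurableSpace Ω} (hm : m ≤ mΩ) {Y : Ω → E} (hY : Measurable[mΩ] Y) :
    ∃ κ : Ω → Measure E, (∀ ω, IsProbabilityMeasure (κ ω)) ∧
      (∀ f : Ω × E → ℝ≥0∞, Measurable[m.prod inferInstance] f →
        ∫⁻ ω, f (ω, Y ω) ∂P = ∫⁻ ω, ∫⁻ y, f (ω, y) ∂κ ω ∂P) ∧
      (∀ S, MeasurableSet S → (fun ω => (κ ω).real S) =ᵐ[P] P⟦Y ⁻¹' S | m⟧) ∧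
      (∀ f : E → ℝ, Measurable f → Integrable (fun ω => f (Y ω)) P →
        (∀ᵐ ω ∂P, Integrable f (κ ω)) ∧
          P[fun ω => f (Y ω) | m] =ᵐ[P] fun ω => ∫ y, f y ∂κ ω) := by
  have h := @exists_condLaw_of_comap Ω mΩ P _ E Ω _ _ _ m id (measurable_id'' hm) Y hY
  rw [MeasurableSpace.comap_id] at h
  exact h

/-- If the conditional probabilities of all events about `Y` are given by the probability measures
`G ω`, then `G` serves as a conditional law of `Y`. -/
lemma lintegral_eq_of_condProb {E : Type*} [MeasurableSpace E] [StandardBorelSpace E] [Nonempty E]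
    {m : MeasurableSpace Ω} (hm : m ≤ mΩ) {Y : Ω → E} (hY : Measurable[mΩ] Y) {G : Ω → Measure E}
    (hG : ∀ ω, IsProbabilityMeasure (G ω))
    (hlaw : ∀ S, MeasurableSet S → P⟦Y ⁻¹' S | m⟧ =ᵐ[P] fun ω => (G ω).real S)
    {f : Ω × E → ℝ≥0∞} (hf : Measurable[m.prod inferInstance] f) :
    ∫⁻ ω, f (ω, Y ω) ∂P = ∫⁻ ω, ∫⁻ y, f (ω, y) ∂G ω ∂P := by
  obtain ⟨κ, hκ, hdis, hprob, -⟩ := exists_condLaw (P := P) hm hY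
  rw [hdis f hf]
  have hae : ∀ᵐ ω ∂P, κ ω = G ω := by
    set 𝒜 := generateSetAlgebra (MeasurableSpace.countableGeneratingSet E)
    have hgen : MeasurableSpace.generateFrom 𝒜 = ‹MeasurableSpace E› := by
      rw [generateFrom_generateSetAlgebra_eq, MeasurableSpace.generateFrom_countableGeneratingSet]
    have hpi : ∀ᵐ ω ∂P, ∀ S ∈ 𝒜, (κ ω).real S = (G ω).real S := by
      rw [ae_ball_iff (countable_generateSetAlgebra
        MeasurableSpace.countable_countableGeneratingSet)]
      intro S hS
      have hS' : MeasurableSet S := by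
        rw [← hgen]; exact MeasurableSpace.measurableSet_generateFrom hS
      exact (hprob S hS').trans (hlaw S hS')
    filter_upwards [hpi] with ω hω
    have := hκ ω
    have := hG ω
    refine ext_of_generate_finite 𝒜 hgen.symm
      (fun s hs t ht _ => isSetAlgebra_generateSetAlgebra.inter_mem hs ht) ?_ (by simp)
    exact fun S hS => (measureReal_eq_measureReal_iff).1 (hω S hS)
  exact lintegral_congr_ae (hae.mono fun ω h => by simp only [h])

/-- The conditional moment generating function bounds of a sub-Gaussian variable, simultaneously
for all arguments. -/
lemma CondSubGaussian.exists_condLaw {m : MeasurableSpace Ω} (hm : m ≤ mΩ) {X : Ω → ℝ} {R : ℝ}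
    (hX : Measurable[mΩ] X) (h : CondSubGaussian P m X R) :
    ∃ κ : Ω → Measure ℝ, (∀ ω, IsProbabilityMeasure (κ ω)) ∧
      (∀ f : Ω × ℝ → ℝ≥0∞, Measurable[m.prod inferInstance] f →
        ∫⁻ ω, f (ω, X ω) ∂P = ∫⁻ ω, ∫⁻ y, f (ω, y) ∂κ ω ∂P) ∧
      ∀ᵐ ω ∂P, ∀ ξ : ℝ, ∫⁻ x, ENNReal.ofReal (Real.exp (ξ * x)) ∂κ ω
        ≤ ENNReal.ofReal (Real.exp (ξ ^ 2 * R ^ 2 / 2)) := by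
  obtain ⟨κ, hκ, hdis, -, hint⟩ := SpectralTS.exists_condLaw (P := P) hm hX
  refine ⟨κ, hκ, hdis, ?_⟩
  have hrat : ∀ᵐ ω ∂P, ∀ ξ : ℚ, ∫⁻ x, ENNReal.ofReal (Real.exp (ξ * x)) ∂κ ω
      ≤ ENNReal.ofReal (Real.exp ((ξ : ℝ) ^ 2 * R ^ 2 / 2)) := by
    rw [ae_all_iff]
    intro ξ
    obtain ⟨h1, h2⟩ := hint (fun x => Real.exp (ξ * x)) (by fun_prop) (h ξ).1
    filter_upwards [h1, h2, (h ξ).2] with ω ha hb hc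
    rw [← ofReal_integral_eq_lintegral_ofReal ha (ae_of_all _ fun _ => Real.exp_nonneg _), ← hb]
    exact ENNReal.ofReal_le_ofReal hc
  filter_upwards [hrat] with ω hω ξ
  -- Fatou's lemma along rationals converging to `ξ`.
  obtain ⟨q, hq⟩ : ∃ q : ℕ → ℚ, Filter.Tendsto (fun n => (q n : ℝ)) Filter.atTop (nhds ξ) := by
    obtain ⟨s, hs1, hs2⟩ := mem_closure_iff_seq_limit.1 (Rat.denseRange_cast (𝕜 := ℝ) ξ)
    choose q hq using hs1
    exact ⟨q, by simpa [hq] using hs2⟩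
  have hlim : ∀ x, Filter.Tendsto (fun n => ENNReal.ofReal (Real.exp ((q n : ℝ) * x)))
      Filter.atTop (nhds (ENNReal.ofReal (Real.exp (ξ * x)))) := fun x =>
    ENNReal.tendsto_ofReal ((Real.continuous_exp.tendsto _).comp (hq.mul_const x))
  have hlim2 : Filter.Tendsto (fun n => ENNReal.ofReal (Real.exp ((q n : ℝ) ^ 2 * R ^ 2 / 2)))
      Filter.atTop (nhds (ENNReal.ofReal (Real.exp (ξ ^ 2 * R ^ 2 / 2)))) :=
    ENNReal.tendsto_ofReal ((Real.continuous_exp.tendsto _).comp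
      (((hq.pow 2).mul_const _).div_const _))
  calc ∫⁻ x, ENNReal.ofReal (Real.exp (ξ * x)) ∂κ ω
      = ∫⁻ x, Filter.liminf (fun n => ENNReal.ofReal (Real.exp ((q n : ℝ) * x))) Filter.atTop
          ∂κ ω := lintegral_congr fun x => (hlim x).liminf_eq.symm
    _ ≤ Filter.liminf (fun n => ∫⁻ x, ENNReal.ofReal (Real.exp ((q n : ℝ) * x)) ∂κ ω)
          Filter.atTop := lintegral_liminf_le fun n => by fun_prop
    _ ≤ Filter.liminf (fun n => ENNReal.ofReal (Real.exp ((q n : ℝ) ^ 2 * R ^ 2 / 2)))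
          Filter.atTop := Filter.liminf_le_liminf (Filter.Eventually.of_forall fun n => hω (q n))
    _ = _ := hlim2.liminf_eq

lemma CondSubGaussian.ae_eq_zero {m : MeasurableSpace Ω} (hm : m ≤ mΩ) {X : Ω → ℝ}
    (h : CondSubGaussian P m X 0) : ∀ᵐ ω ∂P, X ω = 0 := by
  have hle : ∀ ξ : ℝ, ∫ ω, Real.exp (ξ * X ω) ∂P ≤ 1 := fun ξ => by
    rw [← integral_condExp hm]
    calc _ ≤ ∫ _, (1 : ℝ) ∂P := integral_mono_ae integrable_condExp (integrable_const _)
          ((h ξ).2.mono fun ω hω => by simpa using hω)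
      _ = 1 := by simp
  have hint : Integrable (fun ω => Real.exp (1 * X ω) + Real.exp (-1 * X ω) - 2) P :=
    ((h 1).1.add (h (-1)).1).sub (integrable_const _)
  have hcosh : ∀ x : ℝ, Real.exp (1 * x) + Real.exp (-1 * x) - 2 = 2 * (Real.cosh x - 1) :=
    fun x => by rw [Real.cosh_eq]; ring_nf
  have hnn : 0 ≤ fun ω => Real.exp (1 * X ω) + Real.exp (-1 * X ω) - 2 := fun ω => by
    have := Real.one_le_cosh (X ω)
    simp only [Pi.zero_apply, hcosh]
    linarith
  have hzero : ∫ ω, (Real.exp (1 * X ω) + Real.exp (-1 * X ω) - 2) ∂P = 0 := by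
    refine le_antisymm ?_ (integral_nonneg hnn)
    have e : ∫ ω, (Real.exp (1 * X ω) + Real.exp (-1 * X ω) - 2) ∂P
        = ∫ ω, Real.exp (1 * X ω) ∂P + ∫ ω, Real.exp (-1 * X ω) ∂P - ∫ _, (2 : ℝ) ∂P :=
      (integral_sub ((h 1).1.add (h (-1)).1) (integrable_const _)).trans
        (congrArg (· - _) (integral_add (h 1).1 (h (-1)).1))
    rw [e]
    have := hle 1
    have := hle (-1)
    simp only [integral_const, probReal_univ, smul_eq_mul]
    linarith
  filter_upwards [(integral_eq_zero_iff_of_nonneg hnn hint).1 hzero] with ω hω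
  by_contra hne
  have := Real.one_lt_cosh.2 hne
  simp only [Pi.zero_apply, hcosh] at hω
  linarith

/-- The chord bound for `exp` on `[-θ c, θ c]`. -/
lemma exp_mul_le_cosh_add {θ c x : ℝ} (hc : 0 < c) (hx : |x| ≤ c) :
    Real.exp (θ * x) ≤ Real.cosh (θ * c) + x / c * Real.sinh (θ * c) := by
  obtain ⟨h1, h2⟩ := abs_le.1 hx
  have ha : 0 ≤ (1 + x / c) / 2 := by
    have : -1 ≤ x / c := by rw [le_div_iff₀ hc]; linarith
    linarith
  have hb : 0 ≤ (1 - x / c) / 2 := by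
    have : x / c ≤ 1 := by rw [div_le_iff₀ hc]; linarith
    linarith
  have h := convexOn_exp.2 (Set.mem_univ (θ * c)) (Set.mem_univ (-(θ * c))) ha hb (by ring)
  simp only [smul_eq_mul] at h
  have e : (1 + x / c) / 2 * (θ * c) + (1 - x / c) / 2 * -(θ * c) = θ * x := by
    field_simp; ring
  rw [e] at h
  rw [Real.cosh_eq, Real.sinh_eq]
  linarith

/-- The Azuma-Hoeffding inequality for the sum of bounded supermartingale differences. The
supermartingale property is expressed by testing against bounded nonnegative variables. -/
lemma measure_sum_gt_le {m : ℕ → MeasurableSpace Ω} {X : ℕ → Ω → ℝ} {T : ℕ} {c : ℝ}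
    (hm : ∀ n ≤ T, m n ≤ mΩ) (hmono : Monotone m)
    (hX : ∀ n < T, Measurable[m (n + 1)] (X n)) (hc : 0 < c) (hXc : ∀ n < T, ∀ ω, |X n ω| ≤ c)
    (hsuper : ∀ n < T, ∀ (Z : Ω → ℝ) (B : ℝ), Measurable[m n] Z → (∀ ω, 0 ≤ Z ω) →
      (∀ ω, Z ω ≤ B) → ∫ ω, Z ω * X n ω ∂P ≤ 0)
    (hT : 1 ≤ T) {δ : ℝ} (hδ : 0 < δ) (hδ1 : δ ≤ 1) :
    P.real {ω | c * √(2 * T * Real.log (1 / δ)) < ∑ n ∈ range T, X n ω} ≤ δ := by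
  have hmeasS : ∀ n ≤ T, Measurable[m n] (fun ω => ∑ k ∈ range n, X k ω) := fun n hn =>
    Finset.measurable_sum _ fun k hk =>
      (hX k ((mem_range.1 hk).trans_le hn)).mono (hmono (mem_range.1 hk)) le_rfl
  have hSle : ∀ n ≤ T, ∀ ω, |∑ k ∈ range n, X k ω| ≤ n * c := fun n hn ω => by
    refine (abs_sum_le_sum_abs _ _).trans ?_
    refine (sum_le_sum fun k hk => hXc k ((mem_range.1 hk).trans_le hn) ω).trans ?_
    simp
  set θ : ℝ := √(2 * T * Real.log (1 / δ)) / (T * c) with hθ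
  have hT0 : (0 : ℝ) < T := by exact_mod_cast hT
  have hlog : 0 ≤ Real.log (1 / δ) := Real.log_nonneg (by rw [le_div_iff₀ hδ]; linarith)
  have hθ0 : 0 ≤ θ := by positivity
  have hexp_le : ∀ n ≤ T, ∀ ω, Real.exp (θ * ∑ k ∈ range n, X k ω) ≤ Real.exp (θ * (n * c)) :=
    fun n hn ω => Real.exp_le_exp.2
      (mul_le_mul_of_nonneg_left ((abs_le.1 (hSle n hn ω)).2) hθ0)
  have hint : ∀ n ≤ T, Integrable (fun ω => Real.exp (θ * ∑ k ∈ range n, X k ω)) P :=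
    fun n hn => Integrable.of_bound
      (((hmeasS n hn).mono (hm n hn) le_rfl).const_mul θ).exp.aestronglyMeasurable
      (Real.exp (θ * (n * c))) (ae_of_all _ fun ω => by
        rw [Real.norm_of_nonneg (Real.exp_nonneg _)]; exact hexp_le n hn ω)
  have hmgf : ∀ n ≤ T, ∫ ω, Real.exp (θ * ∑ k ∈ range n, X k ω) ∂P
      ≤ Real.exp (n * ((θ * c) ^ 2 / 2)) := by
    intro n
    induction n with
    | zero => intro _; simp
    | succ n ih =>
      intro hn
      have hn' : n < T := hn
      set Z : Ω → ℝ := fun ω => Real.exp (θ * ∑ k ∈ range n, X k ω) with hZ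
      have hZX : Integrable (fun ω => Z ω * X n ω) P := by
        refine (hint n hn'.le).mul_bdd (c := c)
          ((hX n hn').mono (hm _ hn) le_rfl).aestronglyMeasurable (ae_of_all _ fun ω => ?_)
        exact hXc n hn' ω
      have hstep : ∀ ω, Real.exp (θ * ∑ k ∈ range (n + 1), X k ω)
          ≤ Real.cosh (θ * c) * Z ω + Real.sinh (θ * c) / c * (Z ω * X n ω) := fun ω => by
        rw [sum_range_succ, mul_add, Real.exp_add]
        calc _ ≤ Z ω * (Real.cosh (θ * c) + X n ω / c * Real.sinh (θ * c)) :=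
              mul_le_mul_of_nonneg_left (exp_mul_le_cosh_add hc (hXc n hn' ω)) (Real.exp_nonneg _)
          _ = _ := by ring
      have hneg : ∫ ω, Z ω * X n ω ∂P ≤ 0 :=
        hsuper n hn' Z (Real.exp (θ * (n * c))) ((hmeasS n hn'.le).const_mul θ).exp
          (fun ω => Real.exp_nonneg _) (hexp_le n hn'.le)
      have hsinh : 0 ≤ Real.sinh (θ * c) / c :=
        div_nonneg (Real.sinh_nonneg_iff.2 (by positivity)) hc.le
      calc _ ≤ ∫ ω, (Real.cosh (θ * c) * Z ω + Real.sinh (θ * c) / c * (Z ω * X n ω)) ∂P :=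
            integral_mono (hint _ hn) (((hint n hn'.le).const_mul _).add (hZX.const_mul _)) hstep
        _ = Real.cosh (θ * c) * ∫ ω, Z ω ∂P + Real.sinh (θ * c) / c * ∫ ω, Z ω * X n ω ∂P := by
            rw [integral_add ((hint n hn'.le).const_mul _) (hZX.const_mul _),
              integral_const_mul, integral_const_mul]
        _ ≤ Real.cosh (θ * c) * ∫ ω, Z ω ∂P := by
            nlinarith [mul_nonneg hsinh (neg_nonneg.2 hneg)]
        _ ≤ Real.exp ((θ * c) ^ 2 / 2) * Real.exp (n * ((θ * c) ^ 2 / 2)) := by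
            have h0 : 0 ≤ ∫ ω, Z ω ∂P := integral_nonneg fun ω => Real.exp_nonneg _
            exact mul_le_mul (Real.cosh_le_exp_half_sq _) (ih hn'.le) h0 (Real.exp_nonneg _)
        _ = Real.exp ((n + 1 : ℕ) * ((θ * c) ^ 2 / 2)) := by
            rw [← Real.exp_add]; congr 1; push_cast; ring
  set A : ℝ := √(2 * T * Real.log (1 / δ)) with hA
  have hA2 : A ^ 2 = 2 * T * Real.log (1 / δ) := Real.sq_sqrt (by positivity)
  have hmarkov := mul_meas_ge_le_integral_of_nonneg
    (μ := P) (ae_of_all _ fun ω => Real.exp_nonneg (θ * ∑ k ∈ range T, X k ω)) (hint T le_rfl)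
    (Real.exp (θ * (c * A)))
  have hsub : P.real {ω | c * A < ∑ n ∈ range T, X n ω} ≤
      P.real {ω | Real.exp (θ * (c * A)) ≤ Real.exp (θ * ∑ k ∈ range T, X k ω)} :=
    measureReal_mono fun ω hω =>
      Real.exp_le_exp.2 (mul_le_mul_of_nonneg_left (le_of_lt hω) hθ0)
  refine hsub.trans ?_
  have h1 := hmarkov.trans (hmgf T le_rfl)
  generalize P.real {ω | Real.exp (θ * (c * A)) ≤ Real.exp (θ * ∑ k ∈ range T, X k ω)} = w at h1 ⊢
  have e1 : θ * (c * A) = 2 * Real.log (1 / δ) := by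
    have : θ * (c * A) = A ^ 2 / T := by rw [hθ]; field_simp
    rw [this, hA2]; field_simp
  have e2 : (T : ℝ) * ((θ * c) ^ 2 / 2) = Real.log (1 / δ) := by
    have : (T : ℝ) * ((θ * c) ^ 2 / 2) = A ^ 2 / (2 * T) := by rw [hθ]; field_simp
    rw [this, hA2]; field_simp
  rw [e1, e2, two_mul, Real.exp_add, mul_assoc] at h1
  have h2 := (mul_le_iff_le_one_right (Real.exp_pos _)).1 h1
  rwa [Real.exp_log (by positivity), one_div, inv_mul_le_iff₀ hδ, mul_one] at h2

end Conditional

/-! ### The confidence ellipsoid -/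

section Confidence

open scoped NNReal ENNReal

lemma history_mono {Ω : Type*} {N : ℕ} (a : ℕ → Ω → Fin N) (r : ℕ → Ω → ℝ) :
    Monotone (history a r) := fun _ _ hst =>
  iSup_mono fun _ => iSup_mono' fun h => ⟨h.trans_le hst, le_rfl⟩

lemma comap_arm_le_history {Ω : Type*} {N : ℕ} (a : ℕ → Ω → Fin N) (r : ℕ → Ω → ℝ) {τ t : ℕ}
    (h : τ < t) : MeasurableSpace.comap (a τ) inferInstance ≤ history a r t :=
  le_iSup₂_of_le τ h le_sup_left

lemma measurable_arm_history {Ω : Type*} {N : ℕ} (a : ℕ → Ω → Fin N) (r : ℕ → Ω → ℝ) {τ t : ℕ}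
    (h : τ < t) : Measurable[history a r t] (a τ) :=
  Measurable.mono (comap_measurable (a τ)) (comap_arm_le_history a r h) le_rfl

lemma measurable_reward_history {Ω : Type*} {N : ℕ} (a : ℕ → Ω → Fin N) (r : ℕ → Ω → ℝ)
    {τ t : ℕ} (h : τ < t) : Measurable[history a r t] (r τ) :=
  Measurable.mono (comap_measurable (r τ)) (le_iSup₂_of_le τ h le_sup_right) le_rfl

/-- A quantity that depends only on the arms played before round `t` is measurable as soon as
these arms are, because they take finitely many values. -/
lemma measurable_of_arms {Ω α : Type*} {m : MeasurableSpace Ω} [MeasurableSpace α] {N : ℕ}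
    (i₀ : Fin N) {a : ℕ → Ω → Fin N} {t : ℕ} (ha : ∀ τ < t, Measurable (a τ))
    (F : (ℕ → Fin N) → α) (hF : ∀ b b' : ℕ → Fin N, (∀ τ < t, b τ = b' τ) → F b = F b') :
    Measurable (fun ω => F (fun τ => a τ ω)) := by
  have h1 : Measurable (fun ω => fun i : Fin t => a i ω) :=
    measurable_pi_lambda _ fun i => ha i i.isLt
  have h2 : Measurable (fun f : Fin t → Fin N =>
      F (fun τ => if h : τ < t then f ⟨τ, h⟩ else i₀)) := measurable_of_finite _
  convert h2.comp h1 using 1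
  ext1 ω
  exact hF _ _ fun τ hτ => by simp [hτ]

lemma designMatrix_congr {N : ℕ} (Q : Matrix (Fin N) (Fin N) ℝ) (ev : Fin N → ℝ) (lam : ℝ)
    {b b' : ℕ → Fin N} {t : ℕ} (h : ∀ τ < t, b τ = b' τ) :
    designMatrix Q ev lam b t = designMatrix Q ev lam b' t := by
  rw [designMatrix, designMatrix]
  congr 1
  exact sum_congr rfl fun τ hτ => by rw [h τ (mem_range.1 hτ)]

/-- The density ratio of the method of mixtures, with noise sequence `e` scaled to variance
proxy `1`: the factor by which the Gaussian prior with covariance `Λ⁻¹` rewards the direction of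
the noise sum. -/
noncomputable def mixtureWeight {N : ℕ} (Q : Matrix (Fin N) (Fin N) ℝ) (ev : Fin N → ℝ) (lam : ℝ)
    (a : ℕ → Fin N) (e : ℕ → ℝ) (t : ℕ) : ℝ :=
  √((regSpectrum ev lam).det / (designMatrix Q ev lam a t).det) *
    Real.exp ((∑ τ ∈ range t, e τ • Q (a τ)) ⬝ᵥ
      ((designMatrix Q ev lam a t)⁻¹ *ᵥ (∑ τ ∈ range t, e τ • Q (a τ))) / 2)

variable {Ω : Type*} {mΩ : MeasurableSpace Ω} {P : Measure Ω} [IsProbabilityMeasure P]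
  {N : ℕ} {Q : Matrix (Fin N) (Fin N) ℝ} {ev : Fin N → ℝ} {lam : ℝ}

lemma mixtureWeight_succ (hlam : 0 < lam) (hev : ∀ i, 0 ≤ ev i) (a : ℕ → Fin N) (e : ℕ → ℝ)
    (t : ℕ) :
    mixtureWeight Q ev lam a e (t + 1) = mixtureWeight Q ev lam a e t *
      (√(1 + Q (a t) ⬝ᵥ ((designMatrix Q ev lam a t)⁻¹ *ᵥ Q (a t))))⁻¹ *
      Real.exp ((2 * e t * (Q (a t) ⬝ᵥ ((designMatrix Q ev lam a t)⁻¹ *ᵥ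
            (∑ τ ∈ range t, e τ • Q (a τ))))
          + e t ^ 2 * (Q (a t) ⬝ᵥ ((designMatrix Q ev lam a t)⁻¹ *ᵥ Q (a t)))
          - (Q (a t) ⬝ᵥ ((designMatrix Q ev lam a t)⁻¹ *ᵥ
            (∑ τ ∈ range t, e τ • Q (a τ)))) ^ 2)
        / (1 + Q (a t) ⬝ᵥ ((designMatrix Q ev lam a t)⁻¹ *ᵥ Q (a t))) / 2) := by
  have hD := designMatrix_posDef (Q := Q) hlam hev a t
  have hq : 0 ≤ Q (a t) ⬝ᵥ ((designMatrix Q ev lam a t)⁻¹ *ᵥ Q (a t)) :=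
    posSemidef_quadratic_nonneg hD.inv.posSemidef _
  rw [mixtureWeight, mixtureWeight, designMatrix_succ, sum_range_succ,
    quadratic_inv_add_vecMulVec hD, det_add_vecMulVec_self hD, ← div_div, add_div, Real.exp_add,
    Real.sqrt_div' _ (by linarith)]
  ring

lemma mixtureWeight_zero (hlam : 0 < lam) (hev : ∀ i, 0 ≤ ev i) (a : ℕ → Fin N) (e : ℕ → ℝ) :
    mixtureWeight Q ev lam a e 0 = 1 := by
  simp [mixtureWeight, designMatrix_zero, div_self (regSpectrum_posDef hlam hev).det_pos.ne']

lemma measurable_quadratic_weight {β : Type*} [MeasurableSpace β] {c u s : β → ℝ}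
    (hc : Measurable c) (hu : Measurable u) (hs : Measurable s) {G : Set β} (hG : MeasurableSet G)
    (R : ℝ) : Measurable (fun z : β × ℝ => G.indicator (fun b => ENNReal.ofReal (c b)) z.1 *
      ENNReal.ofReal (Real.exp ((2 * (z.2 / R) * u z.1 + (z.2 / R) ^ 2 * s z.1 - u z.1 ^ 2)
        / (1 + s z.1) / 2))) := by
  have h1 : Measurable (G.indicator (fun b => ENNReal.ofReal (c b))) :=
    hc.ennreal_ofReal.indicator hG
  fun_prop

/-- One step of the supermartingale of the method of mixtures. -/
lemma CondSubGaussian.setLIntegral_quadratic_le {m : MeasurableSpace Ω} (hm : m ≤ mΩ) {X : Ω → ℝ}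
    {R : ℝ} (hX : Measurable[mΩ] X) (h : CondSubGaussian P m X R) {c u s : Ω → ℝ}
    (hc : Measurable[m] c) (hu : Measurable[m] u) (hs : Measurable[m] s)
    (hs0 : ∀ ω, 0 < s ω) {G : Set Ω} (hG : MeasurableSet[m] G) :
    ∫⁻ ω in G, ENNReal.ofReal (c ω) * ENNReal.ofReal (Real.exp
        ((2 * (X ω / R) * u ω + (X ω / R) ^ 2 * s ω - u ω ^ 2) / (1 + s ω) / 2)) ∂P
      ≤ ∫⁻ ω in G, ENNReal.ofReal (c ω) * ENNReal.ofReal √(1 + s ω) ∂P := by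
  obtain ⟨κ, hκ, hdis, hmgf⟩ := h.exists_condLaw hm hX
  have hmeas := @measurable_quadratic_weight Ω m c u s hc hu hs G hG R
  have hd := hdis _ hmeas
  rw [← lintegral_indicator (hm _ hG), ← lintegral_indicator (hm _ hG)]
  calc _ = ∫⁻ ω, G.indicator (fun b => ENNReal.ofReal (c b)) ω * ENNReal.ofReal (Real.exp
        ((2 * (X ω / R) * u ω + (X ω / R) ^ 2 * s ω - u ω ^ 2) / (1 + s ω) / 2)) ∂P := by
        refine lintegral_congr fun ω => ?_
        by_cases hω : ω ∈ G <;> simp [hω]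
    _ = _ := hd
    _ ≤ _ := lintegral_mono_ae ?_
  filter_upwards [hmgf] with ω hω
  have := hκ ω
  rw [lintegral_const_mul _ (by fun_prop)]
  have hsub : ∀ ξ : ℝ, ∫⁻ x, ENNReal.ofReal (Real.exp (ξ * x)) ∂((κ ω).map (fun x => x / R))
      ≤ ENNReal.ofReal (Real.exp (ξ ^ 2 / 2)) := by
    intro ξ
    rw [lintegral_map (by fun_prop) (by fun_prop)]
    have h1 := hω (ξ / R)
    have e1 : ∀ x, ξ / R * x = ξ * (x / R) := fun x => by ring
    simp only [e1] at h1
    refine h1.trans (ENNReal.ofReal_le_ofReal (Real.exp_le_exp.2 ?_))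
    by_cases hR : R = 0
    · simp only [hR, div_zero]
      nlinarith [sq_nonneg ξ]
    · rw [div_pow, div_mul_cancel₀ _ (pow_ne_zero 2 hR)]
  have hq := lintegral_exp_quadratic_le hsub (u ω) (hs0 ω)
  rw [lintegral_map (by fun_prop) (by fun_prop)] at hq
  by_cases hωG : ω ∈ G
  · simp only [hωG, Set.indicator_of_mem]
    gcongr
  · simp [hωG]

end Confidence

section Run

open scoped NNReal ENNReal

variable {Ω : Type*} {mΩ : MeasurableSpace Ω} {P : Measure Ω}
  {N : ℕ} {Q : Matrix (Fin N) (Fin N) ℝ} {ev : Fin N → ℝ} {lam v R : ℝ} {mu : Fin N → ℝ} {T : ℕ}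
  {a : ℕ → Ω → Fin N} {muTilde : ℕ → Ω → EuclideanSpace ℝ (Fin N)} {ε : ℕ → Ω → ℝ}

lemma IsThompsonRun.measurable_reward (hrun : IsThompsonRun P Q ev lam v R mu T a muTilde ε)
    {t : ℕ} (ht : t < T) : Measurable (reward Q mu a ε t) := by
  have h1 : Measurable (fun ω => Q (a t ω) ⬝ᵥ mu) :=
    (measurable_of_finite (fun i : Fin N => Q i ⬝ᵥ mu)).comp (hrun.measurable_arm t ht)
  exact h1.add (hrun.measurable_noise t ht)

lemma IsThompsonRun.history_le (hrun : IsThompsonRun P Q ev lam v R mu T a muTilde ε)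
    {t : ℕ} (ht : t ≤ T) : history a (reward Q mu a ε) t ≤ mΩ :=
  iSup₂_le fun τ hτ => sup_le (hrun.measurable_arm τ (hτ.trans_le ht)).comap_le
    (hrun.measurable_reward (hτ.trans_le ht)).comap_le

lemma measurable_noise_history {τ t : ℕ} (h : τ < t) :
    Measurable[history a (reward Q mu a ε) t] (ε τ) := by
  have h1 := measurable_reward_history a (reward Q mu a ε) h
  have h2 := (measurable_of_finite (fun i : Fin N => Q i ⬝ᵥ mu)).comp
    (measurable_arm_history a (reward Q mu a ε) h)
  have h3 : ε τ = fun ω => reward Q mu a ε τ ω - Q (a τ ω) ⬝ᵥ mu := by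
    ext ω; simp [reward]
  rw [h3]
  exact h1.sub h2

/-- Linear forms in the weighted noise sum whose coefficients depend on the past arms only. -/
lemma measurable_noise_sum_entry {m : MeasurableSpace Ω} {t : ℕ}
    (ha : ∀ τ < t, Measurable (a τ)) {e : ℕ → Ω → ℝ} (he : ∀ τ < t, Measurable (e τ))
    (j : Fin N) : Measurable (fun ω => (∑ τ ∈ range t, e τ ω • Q (a τ ω)) j) := by
  simp only [Finset.sum_apply, Pi.smul_apply, smul_eq_mul]
  refine Finset.measurable_sum _ fun τ hτ => ?_
  exact (he τ (mem_range.1 hτ)).mul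
    ((measurable_of_finite (fun i : Fin N => Q i j)).comp (ha τ (mem_range.1 hτ)))

lemma measurable_inv_design_entry {m : MeasurableSpace Ω} (i₀ : Fin N) {t : ℕ}
    (ha : ∀ τ < t, Measurable (a τ)) (i j : Fin N) :
    Measurable (fun ω => (designMatrix Q ev lam (fun τ => a τ ω) t)⁻¹ i j) :=
  measurable_of_arms i₀ ha (fun b => (designMatrix Q ev lam b t)⁻¹ i j) fun b b' h => by
    simp only [designMatrix_congr Q ev lam h]

lemma measurable_mixtureWeight {m : MeasurableSpace Ω} (i₀ : Fin N) {t : ℕ}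
    (ha : ∀ τ < t, Measurable (a τ)) {e : ℕ → Ω → ℝ} (he : ∀ τ < t, Measurable (e τ)) :
    Measurable (fun ω => mixtureWeight Q ev lam (fun τ => a τ ω) (fun τ => e τ ω) t) := by
  have h1 : Measurable (fun ω => √((regSpectrum ev lam).det /
      (designMatrix Q ev lam (fun τ => a τ ω) t).det)) :=
    measurable_of_arms i₀ ha (fun b => √((regSpectrum ev lam).det /
      (designMatrix Q ev lam b t).det)) fun b b' h => by simp only [designMatrix_congr Q ev lam h]
  refine h1.mul (Measurable.exp (Measurable.div_const ?_ 2))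
  simp only [dotProduct, mulVec]
  refine Finset.measurable_sum _ fun i _ => (measurable_noise_sum_entry ha he i).mul ?_
  exact Finset.measurable_sum _ fun j _ =>
    (measurable_inv_design_entry i₀ ha i j).mul (measurable_noise_sum_entry ha he j)

variable [IsProbabilityMeasure P]

/-- The mixture weights of the scaled noise `ε / R` form a supermartingale. -/
lemma IsThompsonRun.setLIntegral_mixtureWeight_succ_le
    (hrun : IsThompsonRun P Q ev lam v R mu T a muTilde ε) (i₀ : Fin N)
    (hlam : 0 < lam) (hev : ∀ i, 0 ≤ ev i) (hQ : ∀ i, Q i ⬝ᵥ Q i = 1)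
    {t : ℕ} (ht : t < T) {G : Set Ω} (hG : MeasurableSet[history a (reward Q mu a ε) t] G) :
    ∫⁻ ω in G, ENNReal.ofReal (mixtureWeight Q ev lam (fun τ => a τ ω)
        (fun τ => ε τ ω / R) (t + 1)) ∂P ≤
      ∫⁻ ω in G, ENNReal.ofReal (mixtureWeight Q ev lam (fun τ => a τ ω)
        (fun τ => ε τ ω / R) t) ∂P := by
  set m := history a (reward Q mu a ε) t ⊔ MeasurableSpace.comap (a t) inferInstance with hmdef
  have hle : history a (reward Q mu a ε) t ≤ m := le_sup_left
  have hm : m ≤ mΩ := sup_le (hrun.history_le ht.le) (hrun.measurable_arm t ht).comap_le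
  have hat : Measurable[m] (a t) := Measurable.mono (comap_measurable (a t)) le_sup_right le_rfl
  have ha : ∀ τ < t, Measurable[m] (a τ) := fun τ hτ =>
    (measurable_arm_history a (reward Q mu a ε) hτ).mono hle le_rfl
  have ha' : ∀ τ < t + 1, Measurable[m] (a τ) := fun τ hτ => by
    rcases Nat.lt_succ_iff_lt_or_eq.1 hτ with h | rfl
    exacts [ha τ h, hat]
  have he : ∀ τ < t, Measurable[m] (fun ω => ε τ ω / R) := fun τ hτ =>
    (((measurable_noise_history (Q := Q) (mu := mu) (a := a) hτ).mono hle le_rfl)).div_const R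
  set s : Ω → ℝ := fun ω => Q (a t ω) ⬝ᵥ
    ((designMatrix Q ev lam (fun τ => a τ ω) t)⁻¹ *ᵥ Q (a t ω)) with hs
  set u : Ω → ℝ := fun ω => Q (a t ω) ⬝ᵥ ((designMatrix Q ev lam (fun τ => a τ ω) t)⁻¹ *ᵥ
    (∑ τ ∈ range t, (ε τ ω / R) • Q (a τ ω))) with hu
  set w : Ω → ℝ := fun ω => mixtureWeight Q ev lam (fun τ => a τ ω) (fun τ => ε τ ω / R) t
    with hw
  have hsm : Measurable[m] s := measurable_of_arms i₀ ha'
    (fun b => Q (b t) ⬝ᵥ ((designMatrix Q ev lam b t)⁻¹ *ᵥ Q (b t))) fun b b' h => by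
      simp only [designMatrix_congr Q ev lam fun τ hτ => h τ (hτ.trans (Nat.lt_succ_self t)),
        h t (Nat.lt_succ_self t)]
  have hum : Measurable[m] u := by
    simp only [hu, dotProduct, mulVec]
    refine Finset.measurable_sum _ fun i _ =>
      ((measurable_of_finite (fun k : Fin N => Q k i)).comp hat).mul ?_
    exact Finset.measurable_sum _ fun j _ =>
      (measurable_inv_design_entry i₀ ha i j).mul (measurable_noise_sum_entry ha he j)
  have hwm : Measurable[m] w := measurable_mixtureWeight i₀ ha he
  have hD : ∀ ω, (designMatrix Q ev lam (fun τ => a τ ω) t).PosDef := fun ω =>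
    designMatrix_posDef hlam hev _ t
  have hs0 : ∀ ω, 0 < s ω := fun ω => posDef_quadratic_pos (hD ω).inv fun h0 => by
    simpa [h0] using hQ (a t ω)
  have hw0 : ∀ ω, 0 ≤ w ω := fun ω => mul_nonneg (Real.sqrt_nonneg _) (Real.exp_nonneg _)
  have hc0 : ∀ ω, 0 ≤ w ω * (√(1 + s ω))⁻¹ := fun ω =>
    mul_nonneg (hw0 ω) (inv_nonneg.2 (Real.sqrt_nonneg _))
  have hsm1 : Measurable[m] fun ω => (√(1 + s ω))⁻¹ := (hsm.const_add 1).sqrt.inv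
  have hcm : Measurable[m] fun ω => w ω * (√(1 + s ω))⁻¹ := hwm.mul hsm1
  have h := (hrun.noise_subGaussian t ht).setLIntegral_quadratic_le hm
    (hrun.measurable_noise t ht) hcm hum hsm hs0 (hle _ hG)
  refine le_trans (le_of_eq ?_) (h.trans (le_of_eq ?_))
  · refine lintegral_congr fun ω => ?_
    rw [mixtureWeight_succ hlam hev, ← ENNReal.ofReal_mul (hc0 ω)]
  · refine lintegral_congr fun ω => ?_
    have hsp : √(1 + s ω) ≠ 0 := (Real.sqrt_pos.2 (by linarith [hs0 ω])).ne'
    rw [← ENNReal.ofReal_mul (hc0 ω), mul_assoc, inv_mul_cancel₀ hsp, mul_one]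

/-- With high probability all mixture weights stay below `1 / δ`. -/
lemma IsThompsonRun.measure_mixtureWeight_ge_le
    (hrun : IsThompsonRun P Q ev lam v R mu T a muTilde ε) (i₀ : Fin N)
    (hlam : 0 < lam) (hev : ∀ i, 0 ≤ ev i) (hQ : ∀ i, Q i ⬝ᵥ Q i = 1) {δ : ℝ} (hδ : 0 < δ) :
    P {ω | ∃ t < T, 1 / δ ≤ mixtureWeight Q ev lam (fun τ => a τ ω) (fun τ => ε τ ω / R) t}
      ≤ ENNReal.ofReal δ := by
  have h := mul_measure_exists_ge_le (P := P) (T := T)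
    (m := history a (reward Q mu a ε))
    (M := fun t ω => ENNReal.ofReal (mixtureWeight Q ev lam (fun τ => a τ ω)
      (fun τ => ε τ ω / R) t)) (fun n hn => hrun.history_le hn) (history_mono _ _)
    (fun n _ => (measurable_mixtureWeight i₀
      (fun τ hτ => measurable_arm_history a (reward Q mu a ε) hτ)
      (fun τ hτ => (measurable_noise_history (Q := Q) (mu := mu) (a := a) hτ).div_const
        R)).ennreal_ofReal)
    (fun n hn G hG => hrun.setLIntegral_mixtureWeight_succ_le i₀ hlam hev hQ hn hG)
    (ENNReal.ofReal (1 / δ))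
  simp only [mixtureWeight_zero hlam hev, ENNReal.ofReal_one, lintegral_one, measure_univ] at h
  have hsub : {ω | ∃ t < T, 1 / δ ≤ mixtureWeight Q ev lam (fun τ => a τ ω)
      (fun τ => ε τ ω / R) t} ⊆ {ω | ∃ n < T, ENNReal.ofReal (1 / δ) ≤ ENNReal.ofReal
        (mixtureWeight Q ev lam (fun τ => a τ ω) (fun τ => ε τ ω / R) n)} :=
    fun ω ⟨t, ht, hle⟩ => ⟨t, ht, ENNReal.ofReal_le_ofReal hle⟩
  refine (measure_mono hsub).trans ?_
  have hinv : ENNReal.ofReal (1 / δ) = (ENNReal.ofReal δ)⁻¹ := by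
    rw [one_div, ENNReal.ofReal_inv_of_pos hδ]
  rw [hinv] at h ⊢
  rwa [mul_comm, ← div_eq_mul_inv, ENNReal.div_le_iff (by simpa using hδ) ENNReal.ofReal_ne_top,
    one_mul] at h

/-- With high probability the estimates are accurate in all rounds and all directions `b_i`, up
to the multiple `R √(2 d log (1 + T / lam) + 2 log (1 / δ)) + C` of the width `‖b_i‖_{B_t⁻¹}`. -/
lemma IsThompsonRun.measure_estimate_error_gt_le
    (hrun : IsThompsonRun P Q ev lam v R mu T a muTilde ε) (i₀ : Fin N)
    (hlam : 0 < lam) (hev : ∀ i, 0 ≤ ev i) (hmono : Monotone ev) (hQ : ∀ i, Q i ⬝ᵥ Q i = 1)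
    (hT : 1 ≤ T) (hR : 0 ≤ R) {C : ℝ} (hC : matNorm (regSpectrum ev lam) mu ≤ C)
    {δ : ℝ} (hδ : 0 < δ) :
    P {ω | ∃ t < T, ∃ i,
        (R * √(2 * effDim ev lam T * Real.log (1 + T / lam) + 2 * Real.log (1 / δ)) + C) *
          matNorm (designMatrix Q ev lam (fun τ => a τ ω) t)⁻¹ (Q i) <
        |Q i ⬝ᵥ estimate Q ev lam (fun τ => a τ ω) (fun τ => reward Q mu a ε τ ω) t
          - Q i ⬝ᵥ mu|} ≤ ENNReal.ofReal δ := by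
  have hae : ∀ᵐ ω ∂P, ∀ t < T, ε t ω = R * (ε t ω / R) := by
    refine (ae_ball_iff (Set.to_countable {t | t < T})).2 fun t (ht : t < T) => ?_
    by_cases hR0 : R = 0
    · subst hR0
      have hm : history a (reward Q mu a ε) t ⊔ MeasurableSpace.comap (a t) inferInstance ≤ mΩ :=
        sup_le (hrun.history_le ht.le) (hrun.measurable_arm t ht).comap_le
      filter_upwards [(hrun.noise_subGaussian t ht).ae_eq_zero hm] with ω hω
      simp [hω]
    · exact ae_of_all _ fun ω => by field_simp
  refine le_trans (measure_mono_ae ?_)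
    (hrun.measure_mixtureWeight_ge_le i₀ hlam hev hQ hδ)
  filter_upwards [hae] with ω hω
  rintro ⟨t, ht, i, hi⟩
  refine ⟨t, ht, ?_⟩
  by_contra hcon
  push Not at hcon
  refine absurd hi (not_lt.2 ?_)
  have hD := designMatrix_posDef (Q := Q) hlam hev (fun τ => a τ ω) t
  have hΛ := regSpectrum_posDef (ev := ev) hlam hev
  have hdet := log_det_designMatrix_le (Q := Q) hlam hev hmono hQ hT (fun τ => a τ ω) ht.le
  refine (abs_estimate_error_le hlam hev _ _ t mu (Q i)).trans ?_
  rw [mul_comm]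
  refine mul_le_mul_of_nonneg_right (add_le_add ?_ hC) (Real.sqrt_nonneg _)
  have hsum : ∑ τ ∈ range t, (reward Q mu a ε τ ω - Q (a τ ω) ⬝ᵥ mu) • Q (a τ ω)
      = R • ∑ τ ∈ range t, (ε τ ω / R) • Q (a τ ω) := by
    rw [smul_sum]
    refine sum_congr rfl fun τ hτ => ?_
    rw [smul_smul, ← hω τ ((mem_range.1 hτ).trans ht)]
    simp [reward]
  rw [hsum, matNorm]
  unfold mixtureWeight at hcon
  set D := designMatrix Q ev lam (fun τ => a τ ω) t
  set S := ∑ τ ∈ range t, (ε τ ω / R) • Q (a τ ω)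
  have hquad : (R • S) ⬝ᵥ (D⁻¹ *ᵥ (R • S)) = R ^ 2 * (S ⬝ᵥ (D⁻¹ *ᵥ S)) := by
    simp only [mulVec_smul, smul_dotProduct, dotProduct_smul, smul_eq_mul]; ring
  rw [hquad, Real.sqrt_mul (sq_nonneg R), Real.sqrt_sq hR]
  refine mul_le_mul_of_nonneg_left (Real.sqrt_le_sqrt ?_) hR
  have hratio : 0 < (regSpectrum ev lam).det / D.det := div_pos hΛ.det_pos hD.det_pos
  have hinv : Real.log ((regSpectrum ev lam).det / D.det)
      = -Real.log (D.det / (regSpectrum ev lam).det) := by rw [← Real.log_inv, inv_div]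
  have hlog := Real.log_lt_log (by positivity) hcon
  rw [Real.log_mul (Real.sqrt_pos.2 hratio).ne' (Real.exp_ne_zero _), Real.log_exp,
    Real.log_sqrt hratio.le, hinv] at hlog
  linarith

end Run

/-! ### The conditional regret of one round -/

section Round

open scoped NNReal ENNReal

/-- The width `s_i(t) = ‖b_i‖_{B_t⁻¹}` of arm `i` before round `t`. -/
noncomputable def armWidth {N : ℕ} (Q : Matrix (Fin N) (Fin N) ℝ) (ev : Fin N → ℝ) (lam : ℝ)
    (a : ℕ → Fin N) (t : ℕ) (i : Fin N) : ℝ :=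
  matNorm (designMatrix Q ev lam a t)⁻¹ (Q i)

/-- The estimate `b_iᵀ μ̂(t)` of the mean payoff of arm `i` before round `t`. -/
noncomputable def estimatedMean {N : ℕ} (Q : Matrix (Fin N) (Fin N) ℝ) (ev : Fin N → ℝ)
    (lam : ℝ) (a : ℕ → Fin N) (r : ℕ → ℝ) (t : ℕ) (i : Fin N) : ℝ :=
  Q i ⬝ᵥ estimate Q ev lam a r t

/-- The least width of an unsaturated arm, that is an arm whose gap `Δ i` is at most `g` times
its width. -/
noncomputable def minUnsaturated {N : ℕ} (Δ s : Fin N → ℝ) (g : ℝ) : ℝ :=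
  ⨅ i : {i // Δ i ≤ g * s i}, s i

lemma minUnsaturated_le {N : ℕ} {Δ s : Fin N → ℝ} {g : ℝ} {i : Fin N} (hi : Δ i ≤ g * s i) :
    minUnsaturated Δ s g ≤ s i :=
  ciInf_le (f := fun i : {i // Δ i ≤ g * s i} => s i) (Set.finite_range _).bddBelow ⟨i, hi⟩

lemma exists_eq_minUnsaturated {N : ℕ} {Δ s : Fin N → ℝ} {g : ℝ} {i : Fin N}
    (hi : Δ i ≤ g * s i) : ∃ j, Δ j ≤ g * s j ∧ s j = minUnsaturated Δ s g := by
  have : Nonempty {i // Δ i ≤ g * s i} := ⟨⟨i, hi⟩⟩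
  obtain ⟨j, hj⟩ := exists_eq_ciInf_of_finite (f := fun i : {i // Δ i ≤ g * s i} => s i)
  exact ⟨j, j.2, hj⟩

/-- The gap of the arm `j` played, when the samples `x` are within `g s` of the means `y`. -/
lemma gap_le_minUnsaturated {N : ℕ} {x y s : Fin N → ℝ} {g : ℝ} {i₀ j : Fin N}
    (hs : ∀ i, 0 ≤ s i) (hg : 0 ≤ g) (hxy : ∀ i, |x i - y i| ≤ g * s i) (hj : ∀ i, x i ≤ x j) :
    y i₀ - y j ≤ 2 * g * minUnsaturated (fun i => y i₀ - y i) s g + g * s j := by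
  have h0 : y i₀ - y i₀ ≤ g * s i₀ := by rw [sub_self]; exact mul_nonneg hg (hs i₀)
  obtain ⟨k, hk1, hk2⟩ := exists_eq_minUnsaturated (Δ := fun i => y i₀ - y i) h0
  rw [← hk2]
  have h1 := abs_le.1 (hxy k)
  have h2 := abs_le.1 (hxy j)
  have h3 := hj k
  linarith [h1.1, h2.2]

lemma lintegral_ofReal_le_imp {Ω : Type*} {mΩ : MeasurableSpace Ω} {P : Measure Ω}
    {f h : Ω → ℝ} {c : ℝ} (hc : 0 ≤ c) (hf : Integrable f P) (hh : Integrable h P)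
    (hf0 : ∀ ω, 0 ≤ f ω) (hh0 : ∀ ω, 0 ≤ h ω)
    (H : ∫⁻ ω, ENNReal.ofReal (f ω) ∂P ≤ ENNReal.ofReal c * ∫⁻ ω, ENNReal.ofReal (h ω) ∂P) :
    ∫ ω, f ω ∂P ≤ c * ∫ ω, h ω ∂P := by
  rw [← ofReal_integral_eq_lintegral_ofReal hf (ae_of_all _ hf0),
    ← ofReal_integral_eq_lintegral_ofReal hh (ae_of_all _ hh0), ← ENNReal.ofReal_mul hc] at H
  exact (ENNReal.ofReal_le_ofReal_iff (mul_nonneg hc (integral_nonneg hh0))).1 H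

variable {Ω : Type*} {mΩ : MeasurableSpace Ω} {P : Measure Ω}
  {N : ℕ} {Q : Matrix (Fin N) (Fin N) ℝ} {ev : Fin N → ℝ} {lam v R : ℝ} {mu : Fin N → ℝ} {T : ℕ}
  {a : ℕ → Ω → Fin N} {muTilde : ℕ → Ω → EuclideanSpace ℝ (Fin N)} {ε : ℕ → Ω → ℝ}

lemma armWidth_nonneg (b : ℕ → Fin N) (t : ℕ) (i : Fin N) : 0 ≤ armWidth Q ev lam b t i :=
  Real.sqrt_nonneg _

lemma armWidth_le (hlam : 0 < lam) (hev : ∀ i, 0 ≤ ev i) (hQ : ∀ i, Q i ⬝ᵥ Q i = 1)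
    (b : ℕ → Fin N) (t : ℕ) (i : Fin N) : armWidth Q ev lam b t i ≤ 1 / √lam := by
  rw [← Real.sqrt_one, ← Real.sqrt_div' _ hlam.le]
  exact Real.sqrt_le_sqrt (inv_quadratic_le hlam hev b t (hQ i))

lemma armWidth_congr {b b' : ℕ → Fin N} {t : ℕ} (h : ∀ τ < t, b τ = b' τ) :
    armWidth Q ev lam b t = armWidth Q ev lam b' t := by
  ext i; simp only [armWidth, designMatrix_congr Q ev lam h]

lemma measurable_armWidth {m : MeasurableSpace Ω} (i₀ : Fin N) {t : ℕ}
    (ha : ∀ τ < t, Measurable (a τ)) (i : Fin N) :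
    Measurable (fun ω => armWidth Q ev lam (fun τ => a τ ω) t i) :=
  measurable_of_arms i₀ ha (fun b => armWidth Q ev lam b t i) fun b b' h => by
    simp only [armWidth_congr h]

lemma measurable_estimatedMean {m : MeasurableSpace Ω} (i₀ : Fin N) {t : ℕ}
    (ha : ∀ τ < t, Measurable (a τ)) {r : ℕ → Ω → ℝ} (hr : ∀ τ < t, Measurable (r τ))
    (i : Fin N) :
    Measurable (fun ω => estimatedMean Q ev lam (fun τ => a τ ω) (fun τ => r τ ω) t i) := by
  simp only [estimatedMean, estimate, dotProduct, mulVec]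
  refine Finset.measurable_sum _ fun k _ => Measurable.const_mul ?_ _
  exact Finset.measurable_sum _ fun j _ =>
    (measurable_inv_design_entry i₀ ha k j).mul (measurable_noise_sum_entry ha hr j)

/-- The conditional law of the sampled payoff `b_iᵀ μ̃(t)`. -/
lemma map_sample_law (hlam : 0 < lam) (hev : ∀ i, 0 ≤ ev i) (b : ℕ → Fin N) (r : ℕ → ℝ)
    (t : ℕ) (i : Fin N) :
    (multivariateGaussian (WithLp.toLp 2 (estimate Q ev lam b r t))
        (v ^ 2 • (designMatrix Q ev lam b t)⁻¹)).map (fun x => Q i ⬝ᵥ x.ofLp) =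
      gaussianReal (estimatedMean Q ev lam b r t i)
        ((v * armWidth Q ev lam b t i) ^ 2).toNNReal := by
  have hD := designMatrix_posDef (Q := Q) hlam hev b t
  rw [multivariateGaussian_map_dotProduct _ (hD.inv.posSemidef.smul (sq_nonneg v))]
  congr 2
  rw [smul_mulVec, dotProduct_smul, smul_eq_mul, mul_pow, armWidth, matNorm,
    Real.sq_sqrt (posSemidef_quadratic_nonneg hD.inv.posSemidef _)]

lemma measurable_section_dotProduct {β : Type*} [MeasurableSpace β] {w : β → ℝ≥0∞}
    (hw : Measurable w) (c : Fin N → ℝ) (y : ℝ) :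
    Measurable (fun z : β × EuclideanSpace ℝ (Fin N) =>
      w z.1 * {x : EuclideanSpace ℝ (Fin N) | y ≤ c ⬝ᵥ x.ofLp}.indicator 1 z.2) := by
  have h1 : MeasurableSet {x : EuclideanSpace ℝ (Fin N) | y ≤ c ⬝ᵥ x.ofLp} :=
    measurableSet_le measurable_const (by unfold dotProduct; fun_prop)
  exact (hw.comp measurable_fst).mul ((measurable_one.indicator h1).comp measurable_snd)

lemma measurable_section_deviation {β : Type*} [MeasurableSpace β] {w : β → ℝ≥0∞}
    (hw : Measurable w) {c s : β → Fin N → ℝ} (hc : ∀ i, Measurable fun b => c b i)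
    (hs : ∀ i, Measurable fun b => s b i) (θ : ℝ) :
    Measurable (fun z : β × EuclideanSpace ℝ (Fin N) =>
      w z.1 * {x : EuclideanSpace ℝ (Fin N) |
        ∃ i, θ * s z.1 i < |Q i ⬝ᵥ x.ofLp - c z.1 i|}.indicator 1 z.2) := by
  have h1 : MeasurableSet {z : β × EuclideanSpace ℝ (Fin N) |
      ∃ i, θ * s z.1 i < |Q i ⬝ᵥ z.2.ofLp - c z.1 i|} := by
    have : {z : β × EuclideanSpace ℝ (Fin N) |
        ∃ i, θ * s z.1 i < |Q i ⬝ᵥ z.2.ofLp - c z.1 i|}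
        = ⋃ i, {z | θ * s z.1 i < |Q i ⬝ᵥ z.2.ofLp - c z.1 i|} := by ext; simp
    rw [this]
    refine MeasurableSet.iUnion fun i => measurableSet_lt
      (((hs i).comp measurable_fst).const_mul θ) ?_
    have h2 : Measurable fun z : β × EuclideanSpace ℝ (Fin N) => Q i ⬝ᵥ z.2.ofLp := by
      unfold dotProduct; fun_prop
    exact (h2.sub ((hc i).comp measurable_fst)).abs
  exact (hw.comp measurable_fst).mul (measurable_one.indicator h1)

variable [IsProbabilityMeasure P]

lemma IsThompsonRun.lintegral_sample (hrun : IsThompsonRun P Q ev lam v R mu T a muTilde ε)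
    {t : ℕ} (ht : t < T) {f : Ω × EuclideanSpace ℝ (Fin N) → ℝ≥0∞}
    (hf : Measurable[(history a (reward Q mu a ε) t).prod inferInstance] f) :
    ∫⁻ ω, f (ω, muTilde t ω) ∂P = ∫⁻ ω, ∫⁻ x, f (ω, x) ∂multivariateGaussian
        (WithLp.toLp 2 (estimate Q ev lam (fun τ => a τ ω) (fun τ => reward Q mu a ε τ ω) t))
        (v ^ 2 • (designMatrix Q ev lam (fun τ => a τ ω) t)⁻¹) ∂P :=
  lintegral_eq_of_condProb (hrun.history_le ht.le) (hrun.measurable_sample t ht)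
    (fun _ => inferInstance) (hrun.sample_law t ht) hf

/-- Conditionally on the history, the sample is optimistic about arm `i` with probability at
least `1 / (4 e √π)`, wherever the estimate is accurate up to one standard deviation. -/
lemma IsThompsonRun.le_lintegral_optimistic
    (hrun : IsThompsonRun P Q ev lam v R mu T a muTilde ε) (hlam : 0 < lam)
    (hev : ∀ i, 0 ≤ ev i) (hv : 0 ≤ v) {t : ℕ} (ht : t < T) {w : Ω → ℝ≥0∞}
    (hw : Measurable[history a (reward Q mu a ε) t] w) (i : Fin N)
    (hacc : ∀ ω, w ω ≠ 0 → Q i ⬝ᵥ mu ≤ estimatedMean Q ev lam (fun τ => a τ ω)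
      (fun τ => reward Q mu a ε τ ω) t i + v * armWidth Q ev lam (fun τ => a τ ω) t i) :
    ENNReal.ofReal (1 / (4 * Real.exp 1 * √Real.pi)) * ∫⁻ ω, w ω ∂P ≤
      ∫⁻ ω, w ω * {ω | Q i ⬝ᵥ mu ≤ Q i ⬝ᵥ (muTilde t ω).ofLp}.indicator 1 ω ∂P := by
  have hf := @measurable_section_dotProduct N Ω (history a (reward Q mu a ε) t) w hw (Q i)
    (Q i ⬝ᵥ mu)
  have h := hrun.lintegral_sample ht hf
  have hmeas : MeasurableSet {x : EuclideanSpace ℝ (Fin N) | Q i ⬝ᵥ mu ≤ Q i ⬝ᵥ x.ofLp} :=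
    measurableSet_le measurable_const (by unfold dotProduct; fun_prop)
  refine le_of_le_of_eq ?_ h.symm
  rw [← lintegral_const_mul _ (hw.mono (hrun.history_le ht.le) le_rfl)]
  refine lintegral_mono fun ω => ?_
  by_cases hω : w ω = 0
  · simp [hω]
  change _ ≤ ∫⁻ x, w ω * {x : EuclideanSpace ℝ (Fin N) | Q i ⬝ᵥ mu ≤ Q i ⬝ᵥ x.ofLp}.indicator 1 x ∂_
  rw [lintegral_const_mul _ (measurable_one.indicator hmeas), lintegral_indicator_one hmeas,
    mul_comm]
  refine mul_le_mul_right ?_ _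
  have hb := le_gaussianReal_Ici (hacc ω hω) (mul_nonneg hv (armWidth_nonneg _ t i))
  rw [← map_sample_law hlam hev, Measure.map_apply (by unfold dotProduct; fun_prop)
    measurableSet_Ici] at hb
  exact hb

/-- Conditionally on the history, the sampled payoffs are close to their means. -/
lemma IsThompsonRun.lintegral_deviation_le
    (hrun : IsThompsonRun P Q ev lam v R mu T a muTilde ε) (hlam : 0 < lam)
    (hev : ∀ i, 0 ≤ ev i) (hv : 0 ≤ v) {t : ℕ} (ht : t < T) {w : Ω → ℝ≥0∞}
    (hw : Measurable[history a (reward Q mu a ε) t] w) (i₀ : Fin N) {β : ℝ} (hβ : 0 ≤ β) :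
    ∫⁻ ω, w ω * {ω | ∃ i, β * v * armWidth Q ev lam (fun τ => a τ ω) t i <
        |Q i ⬝ᵥ (muTilde t ω).ofLp - estimatedMean Q ev lam (fun τ => a τ ω)
          (fun τ => reward Q mu a ε τ ω) t i|}.indicator 1 ω ∂P ≤
      ENNReal.ofReal (N * (2 * Real.exp (-β ^ 2 / 2))) * ∫⁻ ω, w ω ∂P := by
  have hf := @measurable_section_deviation N Q Ω (history a (reward Q mu a ε) t) w hw
    (fun ω i => estimatedMean Q ev lam (fun τ => a τ ω) (fun τ => reward Q mu a ε τ ω) t i)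
    (fun ω i => armWidth Q ev lam (fun τ => a τ ω) t i)
    (fun i => measurable_estimatedMean i₀ (fun τ hτ => measurable_arm_history a _ hτ)
      (fun τ hτ => measurable_reward_history a _ hτ) i)
    (fun i => measurable_armWidth i₀ (fun τ hτ => measurable_arm_history a _ hτ) i) (β * v)
  have h := hrun.lintegral_sample ht hf
  refine le_of_eq_of_le h ?_
  rw [← lintegral_const_mul _ (hw.mono (hrun.history_le ht.le) le_rfl)]
  refine lintegral_mono fun ω => ?_
  set s := armWidth Q ev lam (fun τ => a τ ω) t with hs
  set c := estimatedMean Q ev lam (fun τ => a τ ω) (fun τ => reward Q mu a ε τ ω) t with hc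
  set G := multivariateGaussian
        (WithLp.toLp 2 (estimate Q ev lam (fun τ => a τ ω) (fun τ => reward Q mu a ε τ ω) t))
        (v ^ 2 • (designMatrix Q ev lam (fun τ => a τ ω) t)⁻¹) with hG
  have hset : {x : EuclideanSpace ℝ (Fin N) | ∃ i, β * v * s i < |Q i ⬝ᵥ x.ofLp - c i|}
      = ⋃ i, (fun x : EuclideanSpace ℝ (Fin N) => Q i ⬝ᵥ x.ofLp) ⁻¹'
          {y | β * (v * s i) < |y - c i|} := by
    ext; simp [mul_assoc]
  have hm1 : ∀ i, MeasurableSet {y : ℝ | β * (v * s i) < |y - c i|} := fun i =>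
    measurableSet_lt measurable_const (by fun_prop)
  have hm2 : ∀ i, Measurable (fun x : EuclideanSpace ℝ (Fin N) => Q i ⬝ᵥ x.ofLp) := fun i => by
    unfold dotProduct; fun_prop
  have hmeas : MeasurableSet {x : EuclideanSpace ℝ (Fin N) |
      ∃ i, β * v * s i < |Q i ⬝ᵥ x.ofLp - c i|} := by
    rw [hset]; exact MeasurableSet.iUnion fun i => hm2 i (hm1 i)
  change ∫⁻ x, w ω * {x : EuclideanSpace ℝ (Fin N) |
    ∃ i, β * v * s i < |Q i ⬝ᵥ x.ofLp - c i|}.indicator 1 x ∂G ≤ _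
  rw [lintegral_const_mul _ (measurable_one.indicator hmeas), lintegral_indicator_one hmeas,
    mul_comm]
  refine mul_le_mul_left ?_ _
  rw [hset]
  refine (measure_iUnion_le _).trans ?_
  rw [tsum_fintype]
  calc _ ≤ ∑ _i : Fin N, ENNReal.ofReal (2 * Real.exp (-β ^ 2 / 2)) := by
        refine sum_le_sum fun i _ => ?_
        rw [← Measure.map_apply (hm2 i) (hm1 i), hG, map_sample_law hlam hev]
        exact gaussianReal_abs_gt_le hβ (mul_nonneg hv (armWidth_nonneg _ t i))
    _ = _ := by
        rw [sum_const, card_univ, Fintype.card_fin, nsmul_eq_mul,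
          ENNReal.ofReal_mul (Nat.cast_nonneg N), ENNReal.ofReal_natCast]

open Classical in
/-- The compensated regret of a round: the regret on the event that the estimates are accurate,
minus a multiple `K` of the width of the arm played and a constant `η`. -/
noncomputable def compensatedRegret (Q : Matrix (Fin N) (Fin N) ℝ) (ev : Fin N → ℝ) (lam : ℝ)
    (mu : Fin N → ℝ) (i₀ : Fin N) (ℓ K η : ℝ) (t : ℕ) (a : ℕ → Fin N) (r : ℕ → ℝ) : ℝ :=
  (if ∀ i, |estimatedMean Q ev lam a r t i - Q i ⬝ᵥ mu| ≤ ℓ * armWidth Q ev lam a t i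
    then Q i₀ ⬝ᵥ mu - Q (a t) ⬝ᵥ mu else 0) - K * armWidth Q ev lam a t (a t) - η

lemma measurableSet_accurate {m : MeasurableSpace Ω} (i₀ : Fin N) {t : ℕ}
    (ha : ∀ τ < t, Measurable (a τ)) {r : ℕ → Ω → ℝ} (hr : ∀ τ < t, Measurable (r τ)) (ℓ : ℝ) :
    MeasurableSet {ω | ∀ i, |estimatedMean Q ev lam (fun τ => a τ ω) (fun τ => r τ ω) t i
      - Q i ⬝ᵥ mu| ≤ ℓ * armWidth Q ev lam (fun τ => a τ ω) t i} := by
  have : {ω | ∀ i, |estimatedMean Q ev lam (fun τ => a τ ω) (fun τ => r τ ω) t i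
      - Q i ⬝ᵥ mu| ≤ ℓ * armWidth Q ev lam (fun τ => a τ ω) t i}
      = ⋂ i, {ω | |estimatedMean Q ev lam (fun τ => a τ ω) (fun τ => r τ ω) t i
      - Q i ⬝ᵥ mu| ≤ ℓ * armWidth Q ev lam (fun τ => a τ ω) t i} := by ext; simp
  rw [this]
  exact MeasurableSet.iInter fun i => measurableSet_le
    ((measurable_estimatedMean i₀ ha hr i).sub_const _).abs
    ((measurable_armWidth i₀ ha i).const_mul ℓ)

lemma measurable_compensatedRegret {m : MeasurableSpace Ω} (i₀ : Fin N) {t : ℕ}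
    (ha : ∀ τ < t + 1, Measurable (a τ)) {r : ℕ → Ω → ℝ} (hr : ∀ τ < t + 1, Measurable (r τ))
    (ℓ K η : ℝ) :
    Measurable (fun ω => compensatedRegret Q ev lam mu i₀ ℓ K η t (fun τ => a τ ω)
      (fun τ => r τ ω)) := by
  have hlt : ∀ τ < t, τ < t + 1 := fun τ h => h.trans (Nat.lt_succ_self t)
  have hgap : Measurable (fun ω => Q i₀ ⬝ᵥ mu - Q (a t ω) ⬝ᵥ mu) :=
    (measurable_of_finite (fun i : Fin N => Q i₀ ⬝ᵥ mu - Q i ⬝ᵥ mu)).comp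
      (ha t (Nat.lt_succ_self t))
  have hwid : Measurable (fun ω => armWidth Q ev lam (fun τ => a τ ω) t (a t ω)) :=
    measurable_of_arms i₀ ha (fun b => armWidth Q ev lam b t (b t)) fun b b' h => by
      simp only [armWidth_congr fun τ hτ => h τ (hlt τ hτ), h t (Nat.lt_succ_self t)]
  exact ((Measurable.ite (measurableSet_accurate i₀ (fun τ h => ha τ (hlt τ h))
    (fun τ h => hr τ (hlt τ h)) ℓ) hgap measurable_const).sub (hwid.const_mul K)).sub_const η

lemma abs_compensatedRegret_le (hlam : 0 < lam) (hev : ∀ i, 0 ≤ ev i)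
    (hQ : ∀ i, Q i ⬝ᵥ Q i = 1) {i₀ : Fin N} (hi₀ : ∀ i, Q i ⬝ᵥ mu ≤ Q i₀ ⬝ᵥ mu) {D c : ℝ}
    (hD : ∀ i, Q i₀ ⬝ᵥ mu - Q i ⬝ᵥ mu ≤ D) {K η : ℝ} (hK : 0 ≤ K) (hη : 0 ≤ η)
    (hDc : D ≤ c) (hKc : K * (1 / √lam) + η ≤ c) (ℓ : ℝ) (t : ℕ) (b : ℕ → Fin N) (r : ℕ → ℝ) :
    |compensatedRegret Q ev lam mu i₀ ℓ K η t b r| ≤ c := by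
  have h1 := hD (b t)
  have h2 := hi₀ (b t)
  have h3 := mul_le_mul_of_nonneg_left (armWidth_le hlam hev hQ b t (b t)) hK
  have h4 := mul_nonneg hK (armWidth_nonneg (Q := Q) (ev := ev) (lam := lam) b t (b t))
  rw [compensatedRegret, abs_le]
  split_ifs <;> constructor <;> linarith

/-- The compensated regrets are supermartingale differences. -/
lemma IsThompsonRun.integral_mul_compensatedRegret_nonpos
    (hrun : IsThompsonRun P Q ev lam v R mu T a muTilde ε) (hlam : 0 < lam)
    (hev : ∀ i, 0 ≤ ev i) (hQ : ∀ i, Q i ⬝ᵥ Q i = 1) {i₀ : Fin N} {D ℓ β g q K : ℝ}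
    (hD : ∀ i, Q i₀ ⬝ᵥ mu - Q i ⬝ᵥ mu ≤ D) (hD0 : 0 ≤ D) (hv : 0 ≤ v) (hβ : 0 ≤ β)
    (hℓv : ℓ ≤ v) (hg : 0 ≤ g) (hℓg : β * v + ℓ ≤ g) (hq : q = N * (2 * Real.exp (-β ^ 2 / 2)))
    (hKg : g ≤ K) (hK : 2 * g ≤ (K - g) * (1 / (4 * Real.exp 1 * √Real.pi) - q))
    {t : ℕ} (ht : t < T) {Z : Ω → ℝ} {B : ℝ}
    (hZ : Measurable[history a (reward Q mu a ε) t] Z) (hZ0 : ∀ ω, 0 ≤ Z ω)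
    (hZB : ∀ ω, Z ω ≤ B) :
    ∫ ω, Z ω * compensatedRegret Q ev lam mu i₀ ℓ K (D * q) t (fun τ => a τ ω)
      (fun τ => reward Q mu a ε τ ω) ∂P ≤ 0 := by
  have hle := hrun.history_le ht.le
  set p := 1 / (4 * Real.exp 1 * √Real.pi) with hp
  have hp0 : 0 ≤ p := by positivity
  have hq0 : 0 ≤ q := by rw [hq]; positivity
  have ha : ∀ τ < t, Measurable[history a (reward Q mu a ε) t] (a τ) :=
    fun τ hτ => measurable_arm_history a _ hτ
  have hr : ∀ τ < t, Measurable[history a (reward Q mu a ε) t] (reward Q mu a ε τ) := fun τ hτ =>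
    measurable_reward_history a _ hτ
  set s : Ω → Fin N → ℝ := fun ω => armWidth Q ev lam (fun τ => a τ ω) t with hs
  set c : Ω → Fin N → ℝ := fun ω => estimatedMean Q ev lam (fun τ => a τ ω)
    (fun τ => reward Q mu a ε τ ω) t with hc
  set E : Set Ω := {ω | ∀ i, |c ω i - Q i ⬝ᵥ mu| ≤ ℓ * s ω i} with hE
  set A : Set Ω := {ω | Q i₀ ⬝ᵥ mu ≤ Q i₀ ⬝ᵥ (muTilde t ω).ofLp} with hA
  set U : Set Ω := {ω | ∃ i, β * v * s ω i < |Q i ⬝ᵥ (muTilde t ω).ofLp - c ω i|} with hU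
  set sbar : Ω → ℝ := fun ω => minUnsaturated (fun i => Q i₀ ⬝ᵥ mu - Q i ⬝ᵥ mu) (s ω) g
    with hsbar
  have hsnn : ∀ ω i, 0 ≤ s ω i := fun ω i => armWidth_nonneg _ t i
  have hi₀sat : ∀ ω, Q i₀ ⬝ᵥ mu - Q i₀ ⬝ᵥ mu ≤ g * s ω i₀ := fun ω => by
    rw [sub_self]; exact mul_nonneg hg (hsnn ω i₀)
  have hsbar0 : ∀ ω, 0 ≤ sbar ω := fun ω => by
    obtain ⟨j, -, hj⟩ := exists_eq_minUnsaturated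
      (Δ := fun i => Q i₀ ⬝ᵥ mu - Q i ⬝ᵥ mu) (hi₀sat ω)
    exact (hsnn ω j).trans_eq hj
  have hsbar1 : ∀ ω, sbar ω ≤ 1 / √lam := fun ω =>
    (minUnsaturated_le (Δ := fun i => Q i₀ ⬝ᵥ mu - Q i ⬝ᵥ mu) (hi₀sat ω)).trans
      (armWidth_le hlam hev hQ _ t i₀)
  have hsbarm : Measurable[history a (reward Q mu a ε) t] sbar := measurable_of_arms i₀ ha
    (fun b => minUnsaturated (fun i => Q i₀ ⬝ᵥ mu - Q i ⬝ᵥ mu) (armWidth Q ev lam b t) g)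
    fun b b' h => by simp only [armWidth_congr h]
  have hEm : MeasurableSet[history a (reward Q mu a ε) t] E := measurableSet_accurate i₀ ha hr ℓ
  -- `W` is the weight `Z` restricted to accurate estimates, times the reference width.
  set W : Ω → ℝ := fun ω => E.indicator (fun ω => Z ω * sbar ω) ω with hW
  have hWm : Measurable[history a (reward Q mu a ε) t] W := (hZ.mul hsbarm).indicator hEm
  have hW0 : ∀ ω, 0 ≤ W ω := fun ω =>
    Set.indicator_nonneg (fun ω _ => mul_nonneg (hZ0 ω) (hsbar0 ω)) ω
  have hWB : ∀ ω, W ω ≤ B * (1 / √lam) := fun ω => by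
    by_cases hω : ω ∈ E
    · simp only [hW, hω, Set.indicator_of_mem]
      exact mul_le_mul (hZB ω) (hsbar1 ω) (hsbar0 ω) ((hZ0 ω).trans (hZB ω))
    · simp only [hW, hω, Set.indicator_of_notMem, not_false_eq_true]
      exact mul_nonneg ((hZ0 ω).trans (hZB ω)) (by positivity)
  have hbdd : ∀ {f : Ω → ℝ} {B' : ℝ}, Measurable[mΩ] f → (∀ ω, 0 ≤ f ω) → (∀ ω, f ω ≤ B') →
      Integrable f P := fun hf h0 hB => Integrable.of_bound hf.aestronglyMeasurable _
    (ae_of_all _ fun ω => by rw [Real.norm_of_nonneg (h0 ω)]; exact hB ω)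
  have hZi : Integrable Z P := hbdd (hZ.mono hle le_rfl) hZ0 hZB
  have hWi : Integrable W P := hbdd (hWm.mono hle le_rfl) hW0 hWB
  have hdotm : ∀ i, Measurable[mΩ] fun ω => Q i ⬝ᵥ (muTilde t ω).ofLp := fun i => by
    have h1 : Measurable fun x : EuclideanSpace ℝ (Fin N) => Q i ⬝ᵥ x.ofLp := by
      unfold dotProduct; fun_prop
    exact h1.comp (hrun.measurable_sample t ht)
  have hAm : MeasurableSet[mΩ] A := measurableSet_le measurable_const (hdotm i₀)
  have hUm : MeasurableSet[mΩ] U := by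
    have : U = ⋃ i, {ω | β * v * s ω i < |Q i ⬝ᵥ (muTilde t ω).ofLp - c ω i|} := by
      ext; simp [hU]
    rw [this]
    refine MeasurableSet.iUnion fun i => measurableSet_lt
      (((measurable_armWidth i₀ ha i).mono hle le_rfl).const_mul _) ?_
    exact ((hdotm i).sub ((measurable_estimatedMean i₀ ha hr i).mono hle le_rfl)).abs
  have hmul_ind : ∀ (f : Ω → ℝ) (S : Set Ω) (ω : Ω), ENNReal.ofReal (f ω * S.indicator 1 ω)
      = ENNReal.ofReal (f ω) * S.indicator 1 ω := fun f S ω => by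
    by_cases h : ω ∈ S <;> simp [h]
  have hind0 : ∀ (S : Set Ω) (ω : Ω), (0 : ℝ) ≤ S.indicator 1 ω := fun S ω =>
    Set.indicator_nonneg (fun _ _ => zero_le_one) ω
  have hindi : ∀ {f : Ω → ℝ} {S : Set Ω}, MeasurableSet[mΩ] S → Integrable f P →
      Integrable (fun ω => f ω * S.indicator 1 ω) P := fun {f S} hS hf => by
    have : (fun ω => f ω * S.indicator (1 : Ω → ℝ) ω) = S.indicator f := by
      ext ω; by_cases h : ω ∈ S <;> simp [h]
    rw [this]; exact hf.indicator hS
  have hopt : p * ∫ ω, W ω ∂P ≤ ∫ ω, W ω * A.indicator 1 ω ∂P := by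
    have h := hrun.le_lintegral_optimistic hlam hev hv ht (w := fun ω => ENNReal.ofReal (W ω))
      hWm.ennreal_ofReal i₀ (fun ω hω => by
        have hωE : ω ∈ E := by
          by_contra hcon
          exact hω (by simp [hW, hcon])
        have h1 := (abs_le.1 (hωE i₀)).1
        have h2 : ℓ * s ω i₀ ≤ v * s ω i₀ := mul_le_mul_of_nonneg_right hℓv (hsnn ω i₀)
        linarith)
    rw [← ofReal_integral_eq_lintegral_ofReal hWi (ae_of_all _ hW0), ← ENNReal.ofReal_mul hp0]
      at h
    simp only [← hmul_ind] at h
    rw [← ofReal_integral_eq_lintegral_ofReal (hindi hAm hWi)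
      (ae_of_all _ fun ω => mul_nonneg (hW0 ω) (hind0 A ω))] at h
    exact (ENNReal.ofReal_le_ofReal_iff
      (integral_nonneg fun ω => mul_nonneg (hW0 ω) (hind0 A ω))).1 h
  have hdev : ∀ {f : Ω → ℝ}, Measurable[history a (reward Q mu a ε) t] f →
      (∀ ω, 0 ≤ f ω) → Integrable f P →
        ∫ ω, f ω * U.indicator 1 ω ∂P ≤ q * ∫ ω, f ω ∂P := fun {f} hf h0 hfi => by
    have h := hrun.lintegral_deviation_le hlam hev hv ht (w := fun ω => ENNReal.ofReal (f ω))
      hf.ennreal_ofReal i₀ hβ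
    simp only [← hmul_ind] at h
    rw [← hq] at h
    exact lintegral_ofReal_le_imp hq0 (hindi hUm hfi) hfi
      (fun ω => mul_nonneg (h0 ω) (hind0 U ω)) h0 h
  have hdevW := hdev hWm hW0 hWi
  have hdevZ := hdev hZ hZ0 hZi
  have hKg0 : 0 ≤ K - g := by linarith
  -- The regret of the round is compared with the width of the best unsaturated arm.
  have hpt : ∀ ω, Z ω * compensatedRegret Q ev lam mu i₀ ℓ K (D * q) t (fun τ => a τ ω)
      (fun τ => reward Q mu a ε τ ω) ≤ 2 * g * W ω - (K - g) * (W ω * A.indicator 1 ω)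
        + (K - g) * (W ω * U.indicator 1 ω) + D * (Z ω * U.indicator 1 ω) - D * q * Z ω := by
    intro ω
    have hsa := hsnn ω (a t ω)
    by_cases hωE : ω ∈ E
    · have hWω : W ω = Z ω * sbar ω := by simp [hW, hωE]
      have hX : compensatedRegret Q ev lam mu i₀ ℓ K (D * q) t (fun τ => a τ ω)
          (fun τ => reward Q mu a ε τ ω)
          = Q i₀ ⬝ᵥ mu - Q (a t ω) ⬝ᵥ mu - K * s ω (a t ω) - D * q :=
        congrArg (fun x => x - _ - _) (if_pos hωE)
      rw [hX, hWω]
      set Δ := Q i₀ ⬝ᵥ mu - Q (a t ω) ⬝ᵥ mu with hΔ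
      have hΔD : Δ ≤ D := hD _
      suffices h : Δ - K * s ω (a t ω) ≤ 2 * g * sbar ω - (K - g) * (sbar ω * A.indicator 1 ω)
          + (K - g) * (sbar ω * U.indicator 1 ω) + D * U.indicator 1 ω by
        have := mul_le_mul_of_nonneg_left h (hZ0 ω)
        linarith
      have hs0 := hsbar0 ω
      by_cases hωU : ω ∈ U
      · have hKs := mul_nonneg (hg.trans hKg) hsa
        have h1 := mul_nonneg hg hs0
        have h2 := mul_nonneg hKg0 hs0
        by_cases hωA : ω ∈ A <;> simp only [hωU, hωA, Set.indicator_of_mem,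
          Set.indicator_of_notMem, not_false_eq_true, Pi.one_apply] <;> linarith
      · have hclose : ∀ i, |Q i ⬝ᵥ (muTilde t ω).ofLp - Q i ⬝ᵥ mu| ≤ g * s ω i := fun i => by
          have h1 : |Q i ⬝ᵥ (muTilde t ω).ofLp - c ω i| ≤ β * v * s ω i := by
            by_contra hcon
            exact hωU ⟨i, not_le.1 hcon⟩
          have h2 := hωE i
          have h3 := mul_le_mul_of_nonneg_right hℓg (hsnn ω i)
          have h4 := abs_sub_le (Q i ⬝ᵥ (muTilde t ω).ofLp) (c ω i) (Q i ⬝ᵥ mu)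
          linarith
        have hgap : Δ ≤ 2 * g * sbar ω + g * s ω (a t ω) :=
          gap_le_minUnsaturated (i₀ := i₀) (x := fun i => Q i ⬝ᵥ (muTilde t ω).ofLp)
            (y := fun i => Q i ⬝ᵥ mu) (hsnn ω) hg hclose (fun i => hrun.arm_maximizes t ht ω i)
        by_cases hωA : ω ∈ A
        · -- An optimistic sample makes the arm played unsaturated.
          have hunsat : Δ ≤ g * s ω (a t ω) := by
            have h1 : Q i₀ ⬝ᵥ mu ≤ Q i₀ ⬝ᵥ (muTilde t ω).ofLp := hωA
            have h2 := hrun.arm_maximizes t ht ω i₀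
            have h3 := (abs_le.1 (hclose (a t ω))).2
            linarith
          have hmin : sbar ω ≤ s ω (a t ω) :=
            minUnsaturated_le (Δ := fun i => Q i₀ ⬝ᵥ mu - Q i ⬝ᵥ mu) hunsat
          have h5 := mul_le_mul_of_nonneg_left hmin hKg0
          simp only [hωU, hωA, Set.indicator_of_mem, Set.indicator_of_notMem, not_false_eq_true,
            Pi.one_apply]
          linarith
        · have h5 := mul_nonneg hKg0 hsa
          simp only [hωU, hωA, Set.indicator_of_notMem, not_false_eq_true]
          linarith
    · have hWω : W ω = 0 := by simp [hW, hωE]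
      have hX : compensatedRegret Q ev lam mu i₀ ℓ K (D * q) t (fun τ => a τ ω)
          (fun τ => reward Q mu a ε τ ω) = 0 - K * s ω (a t ω) - D * q :=
        congrArg (fun x => x - _ - _) (if_neg hωE)
      rw [hX, hWω]
      have h1 := mul_nonneg (hZ0 ω) (mul_nonneg (hg.trans hKg) hsa)
      have h2 := mul_nonneg hD0 (mul_nonneg (hZ0 ω) (hind0 U ω))
      linarith
  have i1 := hWi.const_mul (2 * g)
  have i2 := (hindi hAm hWi).const_mul (K - g)
  have i3 := (hindi hUm hWi).const_mul (K - g)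
  have i4 := (hindi hUm hZi).const_mul D
  have i5 := hZi.const_mul (D * q)
  have hint : ∫ ω, (2 * g * W ω - (K - g) * (W ω * A.indicator 1 ω)
        + (K - g) * (W ω * U.indicator 1 ω) + D * (Z ω * U.indicator 1 ω) - D * q * Z ω) ∂P
      = 2 * g * ∫ ω, W ω ∂P - (K - g) * ∫ ω, W ω * A.indicator 1 ω ∂P
        + (K - g) * ∫ ω, W ω * U.indicator 1 ω ∂P + D * ∫ ω, Z ω * U.indicator 1 ω ∂P
        - D * q * ∫ ω, Z ω ∂P := by
    have e1 := integral_sub i1 i2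
    have e2 := integral_add (i1.sub i2) i3
    have e3 := integral_add ((i1.sub i2).add i3) i4
    have e4 := integral_sub (((i1.sub i2).add i3).add i4) i5
    simp only [Pi.add_apply, Pi.sub_apply] at e1 e2 e3 e4
    rw [e4, e3, e2, e1]
    simp only [integral_const_mul]
  have hW1 : 0 ≤ ∫ ω, W ω ∂P := integral_nonneg hW0
  have hfin : 2 * g * ∫ ω, W ω ∂P - (K - g) * ∫ ω, W ω * A.indicator 1 ω ∂P
        + (K - g) * ∫ ω, W ω * U.indicator 1 ω ∂P + D * ∫ ω, Z ω * U.indicator 1 ω ∂P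
        - D * q * ∫ ω, Z ω ∂P ≤ 0 := by
    have h1 := mul_le_mul_of_nonneg_left hopt hKg0
    have h2 := mul_le_mul_of_nonneg_left hdevW hKg0
    have h3 := mul_le_mul_of_nonneg_left hdevZ hD0
    have h4 := mul_le_mul_of_nonneg_right hK hW1
    linarith
  by_cases hXi : Integrable (fun ω => Z ω * compensatedRegret Q ev lam mu i₀ ℓ K (D * q) t
      (fun τ => a τ ω) (fun τ => reward Q mu a ε τ ω)) P
  · refine (integral_mono hXi ((((i1.sub i2).add i3).add i4).sub i5) hpt).trans ?_
    exact hint.trans_le hfin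
  · rw [integral_undef hXi]

end Round

/-! ### Constants -/

section Constants

lemma optimism_bounds :
    1 / 24 ≤ 1 / (4 * Real.exp 1 * √Real.pi) ∧ 1 / (4 * Real.exp 1 * √Real.pi) ≤ 1 / 10 := by
  have he := Real.exp_one_lt_d9
  have he' := Real.exp_one_gt_d9
  have hπ1 : 1 ≤ √Real.pi := Real.one_le_sqrt.2 (by linarith [Real.pi_gt_three])
  have hπ2 : √Real.pi ≤ 2 := Real.sqrt_le_iff.2 ⟨by norm_num, by linarith [Real.pi_lt_four]⟩
  constructor
  · exact one_div_le_one_div_of_le (by positivity) (by nlinarith)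
  · exact one_div_le_one_div_of_le (by norm_num) (by nlinarith)

lemma half_le_log_two_div {δ : ℝ} (hδ : 0 < δ) (hδ1 : δ < 1) : 1 / 2 ≤ Real.log (2 / δ) := by
  have h1 : Real.log 2 ≤ Real.log (2 / δ) :=
    Real.log_le_log (by norm_num) (by rw [le_div_iff₀ hδ]; linarith)
  linarith [Real.log_two_gt_d9]

lemma add_div_eq_one_add_div {lam : ℝ} (hlam : 0 < lam) (T : ℕ) :
    (lam + T) / lam = 1 + T / lam := by
  rw [add_div, div_self hlam.ne']

lemma log_two_le_log_one_add {lam : ℝ} {T : ℕ} (hlam : 0 < lam) (hT : lam ≤ T) :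
    Real.log 2 ≤ Real.log (1 + T / lam) := by
  have : 1 ≤ (T : ℝ) / lam := by rwa [le_div_iff₀ hlam, one_mul]
  exact Real.log_le_log (by norm_num) (by linarith)

lemma log_add_div_mul {lam δ : ℝ} (hlam : 0 < lam) (hδ : 0 < δ) (T : ℕ) :
    Real.log ((lam + T) / (δ * lam)) = Real.log (1 + T / lam) + Real.log (1 / δ) := by
  rw [← Real.log_mul (by positivity) (by positivity)]
  congr 1
  field_simp

/-- For `lam ≤ T` the confidence radius at level `δ / 2` is below the sampling scale. -/
lemma confidence_le_scale {lam δ : ℝ} {T d : ℕ} (hlam : 0 < lam) (hδ : 0 < δ) (hδ1 : δ < 1)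
    (hT : lam ≤ T) (hd : 1 ≤ d) :
    2 * d * Real.log (1 + T / lam) + 2 * Real.log (1 / (δ / 2))
      ≤ 6 * d * Real.log ((lam + T) / (δ * lam)) := by
  have h1 := log_two_le_log_one_add hlam hT
  have hd' : (1 : ℝ) ≤ d := by exact_mod_cast hd
  have h2 : Real.log (1 / (δ / 2)) = Real.log 2 + Real.log (1 / δ) := by
    rw [← Real.log_mul (by norm_num) (by positivity)]; congr 1; field_simp
  have h3 : 0 ≤ Real.log (1 / δ) := Real.log_nonneg (by rw [le_div_iff₀ hδ]; linarith)
  have h4 := Real.log_two_gt_d9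
  rw [h2, log_add_div_mul hlam hδ]
  nlinarith [mul_le_mul_of_nonneg_right hd' h3, mul_le_mul_of_nonneg_right hd' (by linarith :
    0 ≤ Real.log (1 + T / lam))]

/-- For `2 ≤ T` the confidence radius at level `δ / 2` is below the one at level `δ / T²`. -/
lemma confidence_le_radius {lam δ : ℝ} {T d : ℕ} (hlam : 0 < lam) (hδ : 0 < δ) (hδ1 : δ < 1)
    (hT2 : 2 ≤ T) (hd : 1 ≤ d) :
    2 * d * Real.log (1 + T / lam) + 2 * Real.log (1 / (δ / 2))
      ≤ 2 * d * Real.log ((lam + T) * (T : ℝ) ^ 2 / (δ * lam)) := by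
  have hd' : (1 : ℝ) ≤ d := by exact_mod_cast hd
  have hT' : (2 : ℝ) ≤ T := by exact_mod_cast hT2
  have h2 : Real.log (1 / (δ / 2)) = Real.log 2 + Real.log (1 / δ) := by
    rw [← Real.log_mul (by norm_num) (by positivity)]; congr 1; field_simp
  have h3 : 0 ≤ Real.log (1 / δ) := Real.log_nonneg (by rw [le_div_iff₀ hδ]; linarith)
  have h4 := Real.log_two_gt_d9
  have h5 : Real.log 2 ≤ Real.log T := Real.log_le_log (by norm_num) hT'
  have h6 : Real.log ((lam + T) * (T : ℝ) ^ 2 / (δ * lam))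
      = Real.log (1 + T / lam) + Real.log (1 / δ) + 2 * Real.log T := by
    rw [mul_div_right_comm, Real.log_mul (by positivity) (by positivity), log_add_div_mul hlam hδ,
      Real.log_pow]
    norm_num
  rw [h2, h6]
  nlinarith [mul_le_mul_of_nonneg_right hd' h3, mul_le_mul_of_nonneg_right hd'
    (by linarith : 0 ≤ Real.log T)]

lemma deviation_prob_le {T N : ℕ} (hT : 1 ≤ T) (hN : 1 ≤ N) :
    N * (2 * Real.exp (-√(4 * Real.log ((T : ℝ) * N)) ^ 2 / 2)) ≤ 2 / (T : ℝ) ^ 2 := by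
  have hT' : (1 : ℝ) ≤ T := by exact_mod_cast hT
  have hN' : (1 : ℝ) ≤ N := by exact_mod_cast hN
  have hTN : 0 < (T : ℝ) * N := by positivity
  have h0 : 0 ≤ Real.log ((T : ℝ) * N) := Real.log_nonneg (by nlinarith)
  have h1 : Real.exp (-√(4 * Real.log ((T : ℝ) * N)) ^ 2 / 2) = (((T : ℝ) * N) ^ 2)⁻¹ := by
    rw [Real.sq_sqrt (by positivity), ← Real.exp_log (by positivity : 0 < ((T : ℝ) * N) ^ 2),
      ← Real.exp_neg, Real.log_pow]
    congr 1
    push_cast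
    ring
  rw [h1, mul_pow, ← div_eq_mul_inv, mul_div_assoc', div_le_div_iff₀ (by positivity)
    (by positivity)]
  have h2 : (T : ℝ) ^ 2 * N ≤ T ^ 2 * N ^ 2 :=
    mul_le_mul_of_nonneg_left (by nlinarith) (by positivity)
  nlinarith

/-- The main terms of the regret bound exceed the trivial bound `2 T C / √lam` whenever the
horizon is short compared with `100` or with `lam`. -/
lemma trivial_regret_le {lam δ C g p : ℝ} {T d : ℕ} (hT : 1 ≤ T) (hlam : 0 < lam) (hδ : 0 < δ)
    (hδ1 : δ < 1) (hC : 0 ≤ C) (hCg : C ≤ g) (hp0 : 0 < p) (hp1 : p ≤ 1 / 10) (hd : 1 ≤ d)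
    (h : C = 0 ∨ T < 100 ∨ (T : ℝ) < lam) :
    T * (2 * C / √lam) ≤ 11 * g / p * √((4 + 4 * lam) / lam * d * T * Real.log ((lam + T) / lam))
      + g / p * (11 / √lam) * √(2 * T * Real.log (2 / δ)) := by
  have hT' : (1 : ℝ) ≤ T := by exact_mod_cast hT
  have hd' : (1 : ℝ) ≤ d := by exact_mod_cast hd
  have hg : 0 ≤ g := hC.trans hCg
  have hsl : 0 < √lam := Real.sqrt_pos.2 hlam
  have hgp : 10 * C ≤ g / p := by
    rw [le_div_iff₀ hp0]; nlinarith
  have t1 : 0 ≤ 11 * g / p * √((4 + 4 * lam) / lam * d * T * Real.log ((lam + T) / lam)) := by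
    positivity
  have t2 : 0 ≤ g / p * (11 / √lam) * √(2 * T * Real.log (2 / δ)) := by positivity
  rcases h with h | h | h
  · rw [h]; simp only [mul_zero, zero_div]; linarith
  · have h1 : √T ≤ √(2 * T * Real.log (2 / δ)) := by
      refine Real.sqrt_le_sqrt ?_
      nlinarith [half_le_log_two_div hδ hδ1]
    have h2 : √(T : ℝ) ≤ 10 := Real.sqrt_le_iff.2
      ⟨by norm_num, by have : (T : ℝ) < 100 := by exact_mod_cast h
                       linarith⟩
    have h3 : (T : ℝ) = √T * √T := (Real.mul_self_sqrt (by linarith)).symm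
    have h4 : 10 * C * (11 / √lam) * √T ≤ g / p * (11 / √lam) * √(2 * T * Real.log (2 / δ)) := by
      gcongr
    have h5 : T * (2 * C / √lam) ≤ 10 * C * (11 / √lam) * √T := by
      have e1 : T * (2 * C / √lam) = (2 * √T) * (C / √lam * √T) := by
        conv_lhs => rw [h3]
        ring
      have e2 : 10 * C * (11 / √lam) * √T = 110 * (C / √lam * √T) := by ring
      rw [e1, e2]
      have : 0 ≤ C / √lam * √T := by positivity
      exact mul_le_mul_of_nonneg_right (by linarith) this
    linarith
  · have h1 : T / √lam ≤ √((4 + 4 * lam) / lam * d * T * Real.log ((lam + T) / lam)) := by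
      refine Real.le_sqrt_of_sq_le ?_
      rw [div_pow, Real.sq_sqrt hlam.le, add_div_eq_one_add_div hlam]
      have hx : (T : ℝ) / lam ≤ 1 := by rw [div_le_iff₀ hlam]; linarith
      have hx0 : 0 < (T : ℝ) / lam := by positivity
      have hL : T / lam / 2 ≤ Real.log (1 + T / lam) := by
        refine le_trans ?_ (Real.one_sub_inv_le_log_of_pos (by linarith))
        have : 1 - (1 + (T : ℝ) / lam)⁻¹ = T / lam / (1 + T / lam) := by
          field_simp; ring
        rw [this]
        exact div_le_div_of_nonneg_left hx0.le (by linarith) (by linarith)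
      have h4 : 4 ≤ (4 + 4 * lam) / lam := by rw [le_div_iff₀ hlam]; linarith
      calc (T : ℝ) ^ 2 / lam ≤ 4 * 1 * T * (T / lam / 2) := by
            have : 0 ≤ (T : ℝ) ^ 2 / lam := by positivity
            have e : 4 * 1 * (T : ℝ) * (T / lam / 2) = 2 * (T ^ 2 / lam) := by ring
            linarith
        _ ≤ _ := by gcongr
    have h2 : 110 * C * (T / √lam) ≤ 11 * g / p *
        √((4 + 4 * lam) / lam * d * T * Real.log ((lam + T) / lam)) := by
      have : 110 * C ≤ 11 * g / p := by rw [mul_div_assoc]; linarith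
      gcongr
    have h3 : T * (2 * C / √lam) ≤ 110 * C * (T / √lam) := by
      have e1 : T * (2 * C / √lam) = 2 * (C * (T / √lam)) := by ring
      have : 0 ≤ C * (T / √lam) := by positivity
      nlinarith
    linarith

end Constants

/-! ### The regret bound -/

section Regret

variable {N : ℕ} {Q : Matrix (Fin N) (Fin N) ℝ} {ev : Fin N → ℝ} {lam : ℝ} {mu : Fin N → ℝ}

lemma gap_le (hlam : 0 < lam) (hev : ∀ i, 0 ≤ ev i) (hQ : ∀ i, Q i ⬝ᵥ Q i = 1) {C : ℝ}
    (hC : matNorm (regSpectrum ev lam) mu ≤ C) (i j : Fin N) :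
    Q i ⬝ᵥ mu - Q j ⬝ᵥ mu ≤ 2 * C / √lam := by
  have h : ∀ i, |Q i ⬝ᵥ mu| ≤ C / √lam := fun i =>
    (abs_dotProduct_le_matNorm hlam hev (hQ i) mu).trans (by gcongr)
  have h1 := (abs_le.1 (h i)).2
  have h2 := (abs_le.1 (h j)).1
  rw [mul_div_assoc]
  linarith

lemma sum_armWidth_le (hlam : 0 < lam) (hev : ∀ i, 0 ≤ ev i) (hmono : Monotone ev)
    (hQ : ∀ i, Q i ⬝ᵥ Q i = 1) {T : ℕ} (hT : 1 ≤ T) (b : ℕ → Fin N) :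
    ∑ t ∈ range T, armWidth Q ev lam b t (b t) ≤
      √((4 + 4 * lam) / lam * effDim ev lam T * T * Real.log ((lam + T) / lam)) := by
  refine Real.le_sqrt_of_sq_le ?_
  have h1 := sq_sum_le_card_mul_sum_sq (s := range T)
    (f := fun t => armWidth Q ev lam b t (b t))
  have h2 : ∑ t ∈ range T, armWidth Q ev lam b t (b t) ^ 2 ≤ (1 + lam) / lam *
      Real.log ((designMatrix Q ev lam b T).det / (regSpectrum ev lam).det) := by
    refine le_of_eq_of_le (sum_congr rfl fun t _ => ?_) (sum_sq_width_le hlam hev hQ b T)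
    exact Real.sq_sqrt (posSemidef_quadratic_nonneg
      (designMatrix_posDef hlam hev b t).inv.posSemidef _)
  have h3 := log_det_designMatrix_le hlam hev hmono hQ hT b le_rfl
  have hlog : 0 ≤ Real.log (1 + T / lam) :=
    Real.log_nonneg (by have : 0 ≤ (T : ℝ) / lam := by positivity
                        linarith)
  rw [card_range] at h1
  rw [add_div_eq_one_add_div hlam]
  calc _ ≤ T * ((1 + lam) / lam * (2 * effDim ev lam T * Real.log (1 + T / lam))) := by
        refine h1.trans ?_
        refine mul_le_mul_of_nonneg_left (h2.trans ?_) (Nat.cast_nonneg T)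
        exact mul_le_mul_of_nonneg_left h3 (by positivity)
    _ ≤ 2 * (T * ((1 + lam) / lam * (2 * effDim ev lam T * Real.log (1 + T / lam)))) := by
        have : 0 ≤ T * ((1 + lam) / lam * (2 * effDim ev lam T * Real.log (1 + T / lam))) := by
          positivity
        linarith
    _ = _ := by ring

/-- On the event that all estimates are accurate, the regret is the sum of the compensated
regrets and of their compensators. -/
lemma regret_eq_of_accurate {i₀ : Fin N} {ℓ K η : ℝ} {T : ℕ} {b : ℕ → Fin N} {r : ℕ → ℝ}
    (hacc : ∀ t < T, ∀ i, |estimatedMean Q ev lam b r t i - Q i ⬝ᵥ mu|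
      ≤ ℓ * armWidth Q ev lam b t i) :
    regret Q mu i₀ b T = ∑ t ∈ range T, compensatedRegret Q ev lam mu i₀ ℓ K η t b r
      + K * ∑ t ∈ range T, armWidth Q ev lam b t (b t) + T * η := by
  have h : ∀ t ∈ range T, Q i₀ ⬝ᵥ mu - Q (b t) ⬝ᵥ mu =
      compensatedRegret Q ev lam mu i₀ ℓ K η t b r + K * armWidth Q ev lam b t (b t) + η := by
    intro t ht
    rw [compensatedRegret, if_pos (hacc t (mem_range.1 ht))]
    ring
  rw [regret, sum_congr rfl h, sum_add_distrib, sum_add_distrib, ← mul_sum, sum_const, card_range,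
    nsmul_eq_mul]

/-- The regret bound in the regime where it improves on the trivial one. -/
lemma IsThompsonRun.regret_le {Ω : Type*} {mΩ : MeasurableSpace Ω} {P : Measure Ω}
    [IsProbabilityMeasure P] {R v : ℝ} {T : ℕ} {a : ℕ → Ω → Fin N}
    {muTilde : ℕ → Ω → EuclideanSpace ℝ (Fin N)} {ε : ℕ → Ω → ℝ}
    (hrun : IsThompsonRun P Q ev lam v R mu T a muTilde ε) (hlam : 0 < lam)
    (hev : ∀ i, 0 ≤ ev i) (hmono : Monotone ev) (hQ : ∀ i, Q i ⬝ᵥ Q i = 1) (hR : 0 ≤ R)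
    {δ C : ℝ} (hδ : 0 < δ) (hδ1 : δ < 1) (hC : matNorm (regSpectrum ev lam) mu ≤ C)
    (hCpos : 0 < C) {aStar : Fin N} (haStar : ∀ i, Q i ⬝ᵥ mu ≤ Q aStar ⬝ᵥ mu) {d : ℕ}
    (hd : d = effDim ev lam T) (hT100 : 100 ≤ T) (hTlam : lam ≤ T)
    (hv : v = sampleScale R C lam δ d T) {p g : ℝ}
    (hp : p = 1 / (4 * Real.exp 1 * √Real.pi))
    (hg : g = √(4 * Real.log ((T : ℝ) * N)) * v +
      (R * √(2 * d * Real.log ((lam + T) * (T : ℝ) ^ 2 / (δ * lam))) + C)) :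
    1 - δ ≤ P.real {ω | regret Q mu aStar (fun t => a t ω) T ≤
      11 * g / p * √((4 + 4 * lam) / lam * d * T * Real.log ((lam + T) / lam))
        + g / p * (11 / √lam) * √(2 * T * Real.log (2 / δ))} := by
  have hT : 1 ≤ T := by omega
  have hd1 : 1 ≤ d := hd ▸ one_le_effDim aStar hlam
  have hT100' : (100 : ℝ) ≤ T := by exact_mod_cast hT100
  have hsl : 0 < √lam := Real.sqrt_pos.2 hlam
  obtain ⟨hp1, hp2⟩ := optimism_bounds
  rw [← hp] at hp1 hp2
  have hp0 : 0 < p := by linarith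
  set β := √(4 * Real.log ((T : ℝ) * N)) with hβ
  have hβ0 : 0 ≤ β := Real.sqrt_nonneg _
  have hv0 : 0 ≤ v := by rw [hv, sampleScale]; positivity
  have hgpos : 0 < g := by rw [hg]; positivity
  have hCg : C ≤ g := by
    have h1 : 0 ≤ β * v + R * √(2 * d * Real.log ((lam + T) * (T : ℝ) ^ 2 / (δ * lam))) := by
      positivity
    linarith
  have hg0 : 0 ≤ g := hgpos.le
  set A := √((4 + 4 * lam) / lam * d * T * Real.log ((lam + T) / lam)) with hA
  set F := √(2 * T * Real.log (2 / δ)) with hF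
  have hF1 : 1 ≤ F := by
    refine Real.one_le_sqrt.2 ?_
    have h1 := half_le_log_two_div hδ hδ1
    have h2 : 2 * (100 : ℝ) * (1 / 2) ≤ 2 * T * Real.log (2 / δ) := by gcongr
    linarith
  have hgap := gap_le (mu := mu) hlam hev hQ hC
  set ℓ := R * √(2 * effDim ev lam T * Real.log (1 + T / lam) + 2 * Real.log (1 / (δ / 2))) + C
    with hℓ
  have hℓv : ℓ ≤ v := by
    rw [hℓ, hv, sampleScale, ← hd]
    have := Real.sqrt_le_sqrt (confidence_le_scale hlam hδ hδ1 hTlam hd1)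
    gcongr
  have hℓg : β * v + ℓ ≤ g := by
    rw [hg, hℓ, ← hd]
    have := Real.sqrt_le_sqrt (confidence_le_radius hlam hδ hδ1 (by omega : 2 ≤ T) hd1)
    gcongr
  set q := N * (2 * Real.exp (-β ^ 2 / 2)) with hq
  have hqT : q ≤ 2 / (T : ℝ) ^ 2 := deviation_prob_le hT aStar.pos
  have hq0 : 0 ≤ q := by rw [hq]; positivity
  have hq1 : q ≤ 1 / 5000 := hqT.trans (by
    rw [div_le_div_iff₀ (by positivity) (by norm_num)]; nlinarith)
  set D := 2 * C / √lam with hD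
  have hD0 : 0 ≤ D := by rw [hD]; positivity
  have hDg : D ≤ 2 * (g / √lam) := by rw [hD, mul_div_assoc]; gcongr
  set K := 5 * g / p with hK
  have hgp : 10 * g ≤ g / p := by
    rw [le_div_iff₀ hp0, mul_comm 10 g, mul_assoc]
    exact mul_le_of_le_one_right hg0 (by linarith)
  have hK5 : K = 5 * (g / p) := by rw [hK, mul_div_assoc]
  have hKg : g ≤ K := by linarith
  have hKp : K * p = 5 * g := by rw [hK, div_mul_cancel₀ _ hp0.ne']
  -- The deviation probability `q` is at most `p / 2`, so `(K - g) (p - q) ≥ (5 g - g p) / 2`.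
  have hK2 : 2 * g ≤ (K - g) * (1 / (4 * Real.exp 1 * √Real.pi) - q) := by
    rw [← hp]
    have h1 : (K - g) * (p / 2) ≤ (K - g) * (p - q) :=
      mul_le_mul_of_nonneg_left (by linarith) (by linarith)
    have h2 : (K - g) * (p / 2) = (5 * g - g * p) / 2 := by rw [← hKp]; ring
    have h3 : g * p ≤ g * (1 / 10) := mul_le_mul_of_nonneg_left hp2 hg0
    linarith
  set c := 6 * (g / p / √lam) with hc
  have hgpl : 0 < g / p / √lam := by positivity
  have hgl : 10 * (g / √lam) ≤ g / p / √lam := by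
    rw [mul_div_assoc']; gcongr
  have hDc : D ≤ c := by
    have : 0 < g / √lam := by positivity
    linarith
  have hKc : K * (1 / √lam) + D * q ≤ c := by
    have h1 : K * (1 / √lam) = 5 * (g / p / √lam) := by rw [hK5]; ring
    have h2 : D * q ≤ D * 1 := mul_le_mul_of_nonneg_left (by linarith) hD0
    have : 0 < g / √lam := by positivity
    linarith
  set r := reward Q mu a ε with hr
  set X : ℕ → Ω → ℝ := fun t ω => compensatedRegret Q ev lam mu aStar ℓ K (D * q) t
    (fun τ => a τ ω) (fun τ => r τ ω) with hX
  have hazuma : P.real {ω | c * √(2 * T * Real.log (1 / (δ / 2))) < ∑ t ∈ range T, X t ω}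
      ≤ δ / 2 := by
    refine measure_sum_gt_le (m := history a r) (fun n hn => hrun.history_le hn)
      (history_mono a r) (fun n _ => measurable_compensatedRegret aStar
        (fun τ hτ => measurable_arm_history a r hτ)
        (fun τ hτ => measurable_reward_history a r hτ) ℓ K (D * q)) (by positivity)
      (fun n _ ω => abs_compensatedRegret_le hlam hev hQ haStar (hgap aStar)
        (hg0.trans hKg) (mul_nonneg hD0 hq0) hDc hKc ℓ n _ _)
      (fun n hn Z B hZ hZ0 hZB => hrun.integral_mul_compensatedRegret_nonpos hlam hev hQ
        (hgap aStar) hD0 hv0 hβ0 hℓv hg0 hℓg hq hKg hK2 hn hZ hZ0 hZB)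
      hT (by linarith) (by linarith)
  rw [one_div_div] at hazuma
  have hconf := hrun.measure_estimate_error_gt_le aStar hlam hev hmono hQ hT hR hC
    (half_pos hδ)
  set bad₁ : Set Ω := {ω | ∃ t < T, ∃ i, ℓ * armWidth Q ev lam (fun τ => a τ ω) t i <
    |estimatedMean Q ev lam (fun τ => a τ ω) (fun τ => r τ ω) t i - Q i ⬝ᵥ mu|} with hbad₁
  have hconf' : P.real bad₁ ≤ δ / 2 :=
    ENNReal.toReal_le_of_le_ofReal (half_pos hδ).le hconf
  set good : Set Ω := {ω | regret Q mu aStar (fun t => a t ω) T ≤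
      11 * g / p * A + g / p * (11 / √lam) * F} with hgood
  have hcover : (Set.univ : Set Ω) ⊆ good ∪ (bad₁ ∪ {ω | c * F < ∑ t ∈ range T, X t ω}) := by
    intro ω _
    by_cases h1 : ω ∈ bad₁
    · exact Or.inr (Or.inl h1)
    by_cases h2 : c * F < ∑ t ∈ range T, X t ω
    · exact Or.inr (Or.inr h2)
    refine Or.inl ?_
    change regret Q mu aStar (fun t => a t ω) T ≤ _
    have hacc : ∀ t < T, ∀ i, |estimatedMean Q ev lam (fun τ => a τ ω) (fun τ => r τ ω) t i
        - Q i ⬝ᵥ mu| ≤ ℓ * armWidth Q ev lam (fun τ => a τ ω) t i := by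
      intro t ht i
      by_contra hcon
      exact h1 ⟨t, ht, i, not_le.1 hcon⟩
    rw [regret_eq_of_accurate (K := K) (η := D * q) hacc]
    have hsum := sum_armWidth_le hlam hev hmono hQ hT (fun τ => a τ ω)
    rw [← hd, ← hA] at hsum
    have e1 : K * ∑ t ∈ range T, armWidth Q ev lam (fun τ => a τ ω) t (a t ω)
        ≤ 11 * g / p * A := by
      refine (mul_le_mul_of_nonneg_left hsum (hg0.trans hKg)).trans ?_
      have : K ≤ 11 * g / p := by rw [hK]; gcongr; norm_num
      exact mul_le_mul_of_nonneg_right this (Real.sqrt_nonneg _)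
    have e2 : T * (D * q) ≤ 5 * (g / p / √lam) * F := by
      have h3 : T * q ≤ 1 := by
        calc T * q ≤ T * (2 / (T : ℝ) ^ 2) := by gcongr
          _ = 2 / T := by field_simp
          _ ≤ 1 := by rw [div_le_one (by positivity)]; linarith
      have h4 : T * (D * q) ≤ D := by
        rw [mul_left_comm]; exact mul_le_of_le_one_right hD0 h3
      have h5 : 5 * (g / p / √lam) * 1 ≤ 5 * (g / p / √lam) * F := by gcongr
      have : 0 < g / √lam := by positivity
      linarith
    have e3 : g / p * (11 / √lam) * F = c * F + 5 * (g / p / √lam) * F := by rw [hc]; ring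
    rw [e3]
    have e4 : ∑ t ∈ range T, X t ω ≤ c * F := not_lt.1 h2
    change ∑ t ∈ range T, X t ω + _ + _ ≤ _
    linarith
  have h1 : (1 : ℝ) ≤ P.real good + (P.real bad₁ + P.real {ω | c * F < ∑ t ∈ range T, X t ω}) := by
    rw [← probReal_univ (μ := P)]
    exact (measureReal_mono hcover).trans ((measureReal_union_le _ _).trans
      (by gcongr; exact measureReal_union_le _ _))
  linarith

end Regret

end SpectralTS

theorem theorem1 {Ω : Type*} {mΩ : MeasurableSpace Ω} (P : Measure Ω) [IsProbabilityMeasure P]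
    (N : ℕ) (W Q : Matrix (Fin N) (Fin N) ℝ) (ev : Fin N → ℝ)
    (hbasis : SpectralTS.IsSpectralBasis W Q ev)
    (T : ℕ) (hT : 1 ≤ T)
    (lam δ R C : ℝ) (hlam : 0 < lam) (hδ : 0 < δ) (hδ1 : δ < 1) (hR : 0 ≤ R)
    (mu : Fin N → ℝ)
    (hC : SpectralTS.matNorm (SpectralTS.regSpectrum ev lam) mu ≤ C)
    (hmean : ∀ i, |Q i ⬝ᵥ mu| ≤ 1)
    (aStar : Fin N) (haStar : ∀ i, Q i ⬝ᵥ mu ≤ Q aStar ⬝ᵥ mu)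
    (d : ℕ) (hd : d = SpectralTS.effDim ev lam T)
    (a : ℕ → Ω → Fin N) (muTilde : ℕ → Ω → EuclideanSpace ℝ (Fin N)) (ε : ℕ → Ω → ℝ)
    (hrun : SpectralTS.IsThompsonRun P Q ev lam (SpectralTS.sampleScale R C lam δ d T) R mu T
      a muTilde ε)
    (p g : ℝ) (hp : p = 1 / (4 * Real.exp 1 * √Real.pi))
    (hg : g = √(4 * Real.log ((T : ℝ) * N)) * (R * √(6 * d * Real.log ((lam + T) / (δ * lam))) + C)
      + R * √(2 * d * Real.log ((lam + T) * (T : ℝ) ^ 2 / (δ * lam))) + C) :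
    1 - δ ≤ P.real {ω | SpectralTS.regret Q mu aStar (fun t => a t ω) T ≤
      11 * g / p * √((4 + 4 * lam) / lam * d * T * Real.log ((lam + T) / lam)) + 1 / (T : ℝ)
        + g / p * (11 / √lam + 2) * √(2 * T * Real.log (2 / δ))} := by
  have hev := hbasis.ev_nonneg
  have hQ := hbasis.row_dotProduct_self
  have hd1 : 1 ≤ d := hd ▸ SpectralTS.one_le_effDim aStar hlam
  have hC0 : 0 ≤ C := (Real.sqrt_nonneg _).trans hC
  obtain ⟨hp1, hp2⟩ := SpectralTS.optimism_bounds
  rw [← hp] at hp1 hp2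
  have hp0 : 0 < p := by linarith
  have hCg : C ≤ g := by
    rw [hg]
    exact le_add_of_nonneg_left (by positivity)
  have hg0 : 0 ≤ g := hC0.trans hCg
  -- It suffices to bound the regret by the two main terms.
  suffices h : 1 - δ ≤ P.real {ω | SpectralTS.regret Q mu aStar (fun t => a t ω) T ≤
      11 * g / p * √((4 + 4 * lam) / lam * d * T * Real.log ((lam + T) / lam))
        + g / p * (11 / √lam) * √(2 * T * Real.log (2 / δ))} by
    refine h.trans (measureReal_mono fun ω hω => ?_)
    rw [Set.mem_ofPred_eq] at hω ⊢
    refine le_trans hω ?_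
    have h1 : 0 ≤ 1 / (T : ℝ) := by positivity
    have h2 : g / p * (11 / √lam) * √(2 * T * Real.log (2 / δ)) ≤
        g / p * (11 / √lam + 2) * √(2 * T * Real.log (2 / δ)) := by
      gcongr
      linarith
    linarith
  by_cases htriv : C = 0 ∨ T < 100 ∨ (T : ℝ) < lam
  · have hall : {ω | SpectralTS.regret Q mu aStar (fun t => a t ω) T ≤
        11 * g / p * √((4 + 4 * lam) / lam * d * T * Real.log ((lam + T) / lam))
          + g / p * (11 / √lam) * √(2 * T * Real.log (2 / δ))} = Set.univ := by
      refine Set.eq_univ_of_forall fun ω => ?_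
      refine le_trans ?_
        (SpectralTS.trivial_regret_le hT hlam hδ hδ1 hC0 hCg hp0 hp2 hd1 htriv)
      refine (sum_le_card_nsmul _ _ _ fun t _ =>
        SpectralTS.gap_le (mu := mu) hlam hev hQ hC aStar (a t ω)).trans_eq ?_
      rw [card_range, nsmul_eq_mul]
    rw [hall, probReal_univ]
    linarith
  · push Not at htriv
    obtain ⟨hCne, hT100, hTlam⟩ := htriv
    exact hrun.regret_le hlam hev hbasis.monotone hQ hR hδ hδ1 hC (hC0.lt_of_ne' hCne) haStar hd
      hT100 hTlam rfl hp (by rw [hg, SpectralTS.sampleScale, add_assoc])
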